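/- Let $T\subset\mathbb{R}^2$ be a polygon, i.e. a compact set that is the closure of its interior and whose boundary is a simple closed polygonal line with $n\ge 3$ edges. Let $L(T)$ be its perimeter, $A(T)$ its area, and $\varphi_1,\dots,\varphi_n\in(0,2\pi)$ its inner angles. Let $\Omega\subset\mathbb{R}^2$ be a measurable set of finite area $|\Omega|$, let $r_{\max}>0$, and assume that every point at distance at most $r_{\max}$ from $T$ lies in $\Omega$. A sensor has a position $x\in\Omega$ and a direction $\theta\in[0,2\pi)$, the pair $(x,\theta)$ being uniformly distributed on $\Omega\times[0,2\pi)$; it measures the distance $s=\min\{t\in[0,r_{\max}] : x+t(\cos\theta,\sin\theta)\in T\}$, or reports no detection ($s=\infty$) if there is no such $t$. Put $$g_1(\varphi)=-2+\frac{2(\varphi-\pi)}{\tan\varphi}\quad(\text{with } g_1(3\pi/2)=-2),\qquad G(T)=\sum_{i}\mathbf 1(\varphi_i>\pi)\,g_1(\varphi_i).$$ Call a parameter $\rho$ of $T$ (real-valued, or a property that holds or fails) observable if it is determined by $P(s=0)$ and by $P(s\le s_1)$, $P(s\le s_2)$ for small distinct $s_1,s_2$, in the following sense: there is one function $D$, the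 same for all $T,\Omega,r_{\max}$, such that for all $T,\Omega,r_{\max}$ as above there is $\varepsilon>0$ with $$D\bigl(|\Omega|,s_1,s_2,P(s=0),P(s\le s_1),P(s\le s_2)\bigr)=\rho(T)\qquad\text{for all distinct } s_1,s_2\in(0,\varepsilon).$$ Then: 1. $L(T)$, $A(T)$ and $G(T)$ are observable. 2. $g_1(\varphi)<0$ for all $\varphi\in(\pi,2\pi)$; moreover $G(T)=0$ if $T$ is convex, and $G(T)<0$ if $T$ is not convex. 3. Consequently, convexity of $T$ is observable. -/

import Mathlib

open MeasureTheory Set Filter Topology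

noncomputable section

namespace DistanceSensing

/- The plane is `ℂ`, with its Euclidean distance and its two-dimensional Lebesgue measure. -/

/-- The closed polygonal line through the vertices of `p` has no double points: its vertices are
pairwise distinct, and two different edges meet at most in an endpoint that they share as
consecutive edges. -/
def IsSimplePolygon {n : ℕ} (p : Polygon ℂ n) : Prop :=
  Function.Injective p.vertices ∧
    ∀ i j : Fin n, i ≠ j → ∀ z ∈ p.edgeSet ℝ i ∩ p.edgeSet ℝ j,
      (j = finRotate n i ∧ z = p j) ∨ (i = finRotate n j ∧ z = p i)

/-- A target object: a solid polygon `region` in the plane, i.e. a compact set that is the closure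
of its interior, whose topological boundary is a simple closed polygonal line `outline`
(so that `region` is this line together with the domain enclosed by it). -/
structure Target where
  /-- number of vertices, and of edges -/
  n : ℕ
  three_le : 3 ≤ n
  /-- the boundary polygon, given by its vertices in cyclic order -/
  outline : Polygon ℂ n
  simple : IsSimplePolygon outline
  /-- the set of points of the target object -/
  region : Set ℂ
  isCompact : IsCompact region
  regular : closure (interior region) = region
  frontier_eq : frontier region = outline.boundary ℝ

namespace Target

/-- The length of the `i`-th edge. -/
def edgeLength (T : Target) (i : Fin T.n) : ℝ :=
  dist (T.outline i) (T.outline (finRotate T.n i))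

/-- The perimeter `L(T)`. -/
def perimeter (T : Target) : ℝ := ∑ i, T.edgeLength i

/-- The area `A(T)`. -/
def area (T : Target) : ℝ := volume.real T.region

/-- The inner angle of the target at its `i`-th vertex: the total size of the set of directions
in `[0, 2π)` that point from the vertex into the target. -/
def innerAngle (T : Target) (i : Fin T.n) : ℝ :=
  volume.real {θ : ℝ | θ ∈ Ico 0 (2 * Real.pi) ∧
    ∀ᶠ t : ℝ in 𝓝[>] 0, T.outline i + t * Complex.exp (θ * Complex.I) ∈ T.region}

end Target

/-- `g₁(φ) = -2 + 2 (φ - π) / tan φ`. (At `φ = 3π/2`, where `1 / tan φ = 0`, this gives `-2`.) -/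
def g₁ (φ : ℝ) : ℝ := -2 + 2 * (φ - Real.pi) / Real.tan φ

open Classical in
/-- `∑ᵢ 1(φᵢ > π) g₁(φᵢ)`, over all vertices of the target. -/
def Target.concavity (T : Target) : ℝ :=
  ∑ i, if Real.pi < T.innerAngle i then g₁ (T.innerAngle i) else 0

/-- The distance measured by a sensor at `x` with direction `θ` and maximum range `rmax`: the least
`s ∈ [0, rmax]` such that `x + s (cos θ, sin θ)` lies in `T`, and `⊤` (no detection) if there
is none. -/
def measuredDistance (T : Set ℂ) (rmax : ℝ) (x : ℂ) (θ : ℝ) : EReal :=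
  sInf ((fun s : ℝ => (s : EReal)) ''
    {s : ℝ | 0 ≤ s ∧ s ≤ rmax ∧ x + s * Complex.exp (θ * Complex.I) ∈ T})

/-- A target in a monitored area `Ω` of finite area, with sensors of maximum range `rmax`; all
points within distance `rmax` of the target belong to the monitored area. -/
structure Setting where
  T : Target
  Ω : Set ℂ
  rmax : ℝ
  rmax_pos : 0 < rmax
  measurableSet : MeasurableSet Ω
  volume_ne_top : volume Ω ≠ ⊤
  closedBall_subset : ∀ z ∈ T.region, Metric.closedBall z rmax ⊆ Ω

namespace Setting

/-- The law of a random sensor `(x, θ)`: uniform on `Ω × [0, 2π)`. -/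
def sensorLaw (M : Setting) : Measure (ℂ × ℝ) :=
  ProbabilityTheory.cond volume (M.Ω ×ˢ Ico 0 (2 * Real.pi))

/-- `P(s = 0)`. -/
def probZero (M : Setting) : ℝ :=
  M.sensorLaw.real {q : ℂ × ℝ | measuredDistance M.T.region M.rmax q.1 q.2 = 0}

/-- `P(s ≤ r)`. -/
def probLE (M : Setting) (r : ℝ) : ℝ :=
  M.sensorLaw.real {q : ℂ × ℝ | measuredDistance M.T.region M.rmax q.1 q.2 ≤ (r : EReal)}

end Setting

/-- The parameter `ρ` is determined by `P(s = 0)`, `P(s ≤ s₁)`, `P(s ≤ s₂)` for small distinct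
`s₁`, `s₂`: one and the same decoding rule `D`, which sees only the area of the monitored region,
the two ranges `s₁`, `s₂`, and the three probabilities, returns the value of `ρ` in every setting,
for all sufficiently small distinct positive `s₁`, `s₂`. -/
def ObservableFromSmallRanges {α : Type*} (ρ : Setting → α) : Prop :=
  ∃ D : ℝ → ℝ → ℝ → ℝ → ℝ → ℝ → α, ∀ M : Setting, ∃ ε : ℝ, 0 < ε ∧
    ∀ s₁ s₂ : ℝ, 0 < s₁ → s₁ < ε → 0 < s₂ → s₂ < ε → s₁ ≠ s₂ →
      D (volume.real M.Ω) s₁ s₂ M.probZero (M.probLE s₁) (M.probLE s₂) = ρ M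

end DistanceSensing

end

/-!
Throw a needle of length `r` with uniformly distributed position and direction: the event
`s ≤ r` says that the needle which starts at the sensor meets `T`. For small `r`, twice the number
of components of needle ∩ `T` is the number of ends of the needle in `T` plus the number of edges
it crosses. The number of components is at most one, except that it is two when the needle bridges a
reflex corner from one side to the other. Therefore, for almost every starting point,

  `2 · 1(needle meets T) = 1(start ∈ T) + 1(finish ∈ T) + #(edges met) - 2 · #(corners bridged)`,

which is `Target.two_mul_indicator_sweep`. It is proved from the local shape of `T`: there is a
scale below which `T` is near each frontier point a half plane, a sector or the complement of a sector
(`Target.exists_scale`). This follows from the hypotheses that `T` is regular closed and that its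
frontier is a simple polygonal line, because the frontier cuts a small disc into two connected
pieces, one of which must be inside `T` and the other outside. The Jordan curve theorem is not
needed.

Integrating over the starting point turns the terms into areas: of `T`, of a parallelogram for every
edge (`volume_sweep_segment`), and of a triangle for every reflex corner (`volume_sweep_inter`).
Integrating over the direction gives (`Target.exists_integral_volume_sweep`)

  `2π |Ω| P(s ≤ r) = 2π A(T) + 2 r L(T) + r² G(T) / 4` for all small `r > 0`,

where `g₁` arises from the mean area of the triangles (`exists_wedge_angle`). The three coefficients
are recovered from `P(s = 0)` and two further values by solving linear equations.

Since `g₁ < 0` on `(π, 2π)`, the coefficient `G(T)` vanishes exactly when there is no reflex corner.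
A convex target has none. Conversely, without reflex corners the target is locally convex, and by
the argument of Tietze and Nakajima visibility is then transitive
(`segment_subset_of_segment_subset`). As consecutive vertices see one another along the edges, and
every point sees a frontier point, the target is convex.
-/

noncomputable section

namespace DistanceSensing

/-! ### Areas in the plane -/

/-- The oriented area of the parallelogram spanned by two vectors of the plane. -/
def cross (z w : ℂ) : ℝ := z.re * w.im - z.im * w.re

/-- The starting points of the needles (segments) of length `r` in the direction of the unit vector
`u` that meet `E`. -/
def sweep (r : ℝ) (u : ℂ) (E : Set ℂ) : Set ℂ := {x | ∃ t ∈ Icc 0 r, x + t * u ∈ E}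

lemma cross_swap (z w : ℂ) : cross z w = -cross w z := by simp only [cross]; ring

@[simp] lemma cross_self (z : ℂ) : cross z z = 0 := by simp only [cross]; ring

@[simp] lemma cross_zero_left (z : ℂ) : cross 0 z = 0 := by simp [cross]

@[simp] lemma cross_zero_right (z : ℂ) : cross z 0 = 0 := by simp [cross]

lemma cross_add_left (z z' w : ℂ) : cross (z + z') w = cross z w + cross z' w := by
  simp only [cross, Complex.add_re, Complex.add_im]; ring

lemma cross_add_right (z w w' : ℂ) : cross z (w + w') = cross z w + cross z w' := by
  simp only [cross, Complex.add_re, Complex.add_im]; ring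

lemma cross_neg_left (z w : ℂ) : cross (-z) w = -cross z w := by
  simp only [cross, Complex.neg_re, Complex.neg_im]; ring

lemma cross_neg_right (z w : ℂ) : cross z (-w) = -cross z w := by
  simp only [cross, Complex.neg_re, Complex.neg_im]; ring

@[simp] lemma cross_ofReal_mul_left (a : ℝ) (z w : ℂ) : cross (a * z) w = a * cross z w := by
  simp only [cross, Complex.re_ofReal_mul, Complex.im_ofReal_mul]; ring

@[simp] lemma cross_ofReal_mul_right (a : ℝ) (z w : ℂ) : cross z (a * w) = a * cross z w := by
  simp only [cross, Complex.re_ofReal_mul, Complex.im_ofReal_mul]; ring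

lemma continuous_cross_left (w : ℂ) : Continuous fun z => cross z w := by
  unfold cross; fun_prop

lemma continuous_cross_right (z : ℂ) : Continuous fun w => cross z w := by
  unfold cross; fun_prop

/-- Cramer's rule: coordinates of a vector with respect to two independent vectors. -/
lemma eq_add_of_cross_ne_zero {P Q : ℂ} (h : cross P Q ≠ 0) (w : ℂ) :
    w = ((cross w Q / cross P Q : ℝ) : ℂ) * P + ((cross P w / cross P Q : ℝ) : ℂ) * Q := by
  apply Complex.ext
  · rw [Complex.add_re, Complex.re_ofReal_mul, Complex.re_ofReal_mul, div_mul_eq_mul_div,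
      div_mul_eq_mul_div, ← add_div, eq_div_iff h]
    simp only [cross]
    ring
  · rw [Complex.add_im, Complex.im_ofReal_mul, Complex.im_ofReal_mul, div_mul_eq_mul_div,
      div_mul_eq_mul_div, ← add_div, eq_div_iff h]
    simp only [cross]
    ring

lemma coeffs_eq_zero {P Q : ℂ} (h : cross P Q ≠ 0) {a b : ℝ} (hab : (a : ℂ) * P + b * Q = 0) :
    a = 0 ∧ b = 0 := by
  constructor
  · have := congrArg (fun z => cross z Q) hab
    simp only [cross_add_left, cross_ofReal_mul_left, cross_self, mul_zero, add_zero,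
      cross_zero_left] at this
    exact (mul_eq_zero.1 this).resolve_right h
  · have := congrArg (fun z => cross P z) hab
    simp only [cross_add_right, cross_ofReal_mul_right, cross_self, mul_zero, zero_add,
      cross_zero_right] at this
    exact (mul_eq_zero.1 this).resolve_right h

/-- Parallel vectors: if `cross P w = 0` and `P ≠ 0` then `w` is a real multiple of `P`. -/
lemma exists_eq_mul_of_cross_eq_zero {P w : ℂ} (hP : P ≠ 0) (h : cross P w = 0) :
    ∃ c : ℝ, w = c * P := by
  have hn : P.re * P.re + P.im * P.im ≠ 0 := by
    rw [← Complex.normSq_apply]; simpa using hP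
  refine ⟨(P.re * w.re + P.im * w.im) / (P.re * P.re + P.im * P.im), ?_⟩
  have h' : P.re * w.im - P.im * w.re = 0 := h
  apply Complex.ext
  · rw [Complex.re_ofReal_mul]
    rw [div_mul_eq_mul_div, eq_div_iff hn]
    linear_combination (-P.im) * h'
  · rw [Complex.im_ofReal_mul]
    rw [div_mul_eq_mul_div, eq_div_iff hn]
    linear_combination P.re * h'

lemma volume_image_frame (v P Q : ℂ) (S : Set (ℝ × ℝ)) :
    volume ((fun p : ℝ × ℝ => v + (p.1 * P + p.2 * Q)) '' S)
      = ENNReal.ofReal |cross P Q| * volume S := by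
  let f : ℂ →ₗ[ℝ] ℂ := Complex.reLm.smulRight P + Complex.imLm.smulRight Q
  have hf : ∀ z : ℂ, f z = z.re * P + z.im * Q := fun z => by simp [f]
  have hdet : LinearMap.det f = cross P Q := by
    rw [← LinearMap.det_toMatrix Complex.basisOneI, Matrix.det_fin_two]
    simp [LinearMap.toMatrix_apply, hf, cross]
    ring
  have himg : (fun p : ℝ × ℝ => v + (p.1 * P + p.2 * Q)) '' S
      = (fun z => v + z) '' (f '' (Complex.measurableEquivRealProd ⁻¹' S)) := by
    ext x
    constructor
    · rintro ⟨p, hp, rfl⟩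
      refine ⟨_, ⟨⟨p.1, p.2⟩, ?_, rfl⟩, ?_⟩
      · simpa [Complex.measurableEquivRealProd_apply] using hp
      · simp [hf]
    · rintro ⟨_, ⟨z, hz, rfl⟩, rfl⟩
      refine ⟨(z.re, z.im), ?_, ?_⟩
      · simpa [Complex.measurableEquivRealProd_apply] using hz
      · simp [hf]
  rw [himg, image_add_left, measure_preimage_add, Measure.addHaar_image_linearMap, hdet,
    Complex.volume_preserving_equiv_real_prod.measure_preimage_equiv]

lemma volume_unit_square : volume (Icc (0 : ℝ) 1 ×ˢ Icc (0 : ℝ) 1) = 1 := by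
  rw [Measure.volume_eq_prod, Measure.prod_prod]; simp

lemma volume_unit_triangle :
    volume {p : ℝ × ℝ | 0 ≤ p.2 ∧ p.2 ≤ p.1 ∧ p.1 ≤ 1} = ENNReal.ofReal (1 / 2) := by
  have hcl : IsClosed {p : ℝ × ℝ | 0 ≤ p.2 ∧ p.2 ≤ p.1 ∧ p.1 ≤ 1} := by
    simp only [ofPred_and]
    exact (isClosed_le (by fun_prop) (by fun_prop)).inter
      ((isClosed_le (by fun_prop) (by fun_prop)).inter (isClosed_le (by fun_prop) (by fun_prop)))
  rw [Measure.volume_eq_prod, Measure.prod_apply hcl.measurableSet]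
  have : ∀ x : ℝ, volume (Prod.mk x ⁻¹' {p : ℝ × ℝ | 0 ≤ p.2 ∧ p.2 ≤ p.1 ∧ p.1 ≤ 1})
      = (Icc (0 : ℝ) 1).indicator (fun x => ENNReal.ofReal x) x := by
    intro x
    by_cases hx : x ∈ Icc (0 : ℝ) 1
    · rw [indicator_of_mem hx]
      have : Prod.mk x ⁻¹' {p : ℝ × ℝ | 0 ≤ p.2 ∧ p.2 ≤ p.1 ∧ p.1 ≤ 1} = Icc 0 x := by
        ext y; simp [hx.2]
      rw [this, Real.volume_Icc, sub_zero]
    · rw [indicator_of_notMem hx]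
      have : Prod.mk x ⁻¹' {p : ℝ × ℝ | 0 ≤ p.2 ∧ p.2 ≤ p.1 ∧ p.1 ≤ 1} = ∅ := by
        ext y
        simp only [mem_preimage, mem_ofPred_eq, mem_empty_iff_false, iff_false]
        rintro ⟨h1, h2, h3⟩
        exact hx ⟨h1.trans h2, h3⟩
      rw [this, measure_empty]
  simp_rw [this]
  rw [lintegral_indicator measurableSet_Icc, ← ofReal_integral_eq_lintegral_ofReal]
  · rw [integral_Icc_eq_integral_Ioc, ← intervalIntegral.integral_of_le zero_le_one, integral_id]
    norm_num
  · exact (continuous_id.integrableOn_Icc)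
  · filter_upwards [ae_restrict_mem measurableSet_Icc] with x hx using hx.1

lemma sweep_segment_eq_image {r : ℝ} (hr : 0 < r) (u a b : ℂ) :
    sweep r u (segment ℝ a b) = (fun p : ℝ × ℝ => a + (p.1 * (b - a) + p.2 * (-(r : ℂ) * u))) ''
      (Icc (0 : ℝ) 1 ×ˢ Icc (0 : ℝ) 1) := by
  ext x
  simp only [sweep, segment_eq_image', mem_ofPred_eq, mem_image, Complex.real_smul]
  constructor
  · rintro ⟨t, ht, s, hs, hx⟩
    refine ⟨(s, t / r), ⟨hs, div_nonneg ht.1 hr.le, (div_le_one hr).2 ht.2⟩, ?_⟩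
    have hr' : (r : ℂ) ≠ 0 := by exact_mod_cast hr.ne'
    simp only [Complex.ofReal_div]
    field_simp
    linear_combination hx
  · rintro ⟨⟨s, t⟩, ⟨hs, ht⟩, rfl⟩
    refine ⟨t * r, ⟨mul_nonneg ht.1 hr.le, ?_⟩, s, hs, ?_⟩
    · exact mul_le_of_le_one_left hr.le ht.2
    · simp only [Complex.ofReal_mul]; ring

/-- The starting points of the needles that meet a given segment form a parallelogram. -/
lemma volume_sweep_segment {r : ℝ} (hr : 0 < r) (u a b : ℂ) :
    volume (sweep r u (segment ℝ a b)) = ENNReal.ofReal (r * |cross (b - a) u|) := by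
  rw [sweep_segment_eq_image hr, volume_image_frame, volume_unit_square, mul_one]
  congr 1
  rw [neg_mul, cross_neg_right, cross_ofReal_mul_right, abs_neg, abs_mul, abs_of_pos hr]

lemma volume_sweep_singleton {r : ℝ} (hr : 0 < r) (u v : ℂ) : volume (sweep r u {v}) = 0 := by
  rw [← segment_same ℝ v, volume_sweep_segment hr]; simp

lemma isCompact_sweep {E : Set ℂ} (hE : IsCompact E) (r : ℝ) (u : ℂ) : IsCompact (sweep r u E) := by
  have : sweep r u E = (fun p : ℂ × ℝ => p.1 - p.2 * u) '' (E ×ˢ Icc 0 r) := by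
    ext x
    simp only [sweep, mem_ofPred_eq, mem_image, mem_prod, Prod.exists]
    constructor
    · rintro ⟨t, ht, hx⟩
      exact ⟨_, t, ⟨hx, ht⟩, by ring⟩
    · rintro ⟨e, t, ⟨he, ht⟩, rfl⟩
      exact ⟨t, ht, by simpa using he⟩
  rw [this]
  exact (hE.prod isCompact_Icc).image (by fun_prop)

lemma isCompact_segment (a b : ℂ) : IsCompact (segment ℝ a b) := by
  rw [segment_eq_image]
  exact isCompact_Icc.image (by fun_prop)

/-- If the direction `u = -m P + k Q` crosses the wedge spanned by `P` and `Q` from the side `P` to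
the side `Q`, then the needles meeting both sides start in a triangle. -/
lemma volume_sweep_inter_of_pos {v P Q u : ℂ} {r m k : ℝ} (hr : 0 < r) (hm : 0 < m) (hk : 0 < k)
    (hD : cross P Q ≠ 0) (hu : u = -(m : ℂ) * P + k * Q) (hrm : r * m ≤ 1) (hrk : r * k ≤ 1) :
    volume (sweep r u (segment ℝ v (v + P)) ∩ sweep r u (segment ℝ v (v + Q)))
      = ENNReal.ofReal (r ^ 2 / 2 * (m * k * |cross P Q|)) := by
  have key : sweep r u (segment ℝ v (v + P)) ∩ sweep r u (segment ℝ v (v + Q))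
      = (fun p : ℝ × ℝ => v + (p.1 * ((r * m : ℝ) * P) + p.2 * ((-(r * k) : ℝ) * Q))) ''
        {p : ℝ × ℝ | 0 ≤ p.2 ∧ p.2 ≤ p.1 ∧ p.1 ≤ 1} := by
    ext x
    simp only [sweep, segment_eq_image', mem_ofPred_eq, mem_image, Complex.real_smul,
      add_sub_cancel_left, mem_inter_iff, Prod.exists]
    constructor
    · rintro ⟨⟨t, ht, s, hs, hx⟩, ⟨t', ht', s', hs', hx'⟩⟩
      have e1 : ((s + (t' - t) * -m : ℝ) : ℂ) * P + ((-s' + (t' - t) * k : ℝ) : ℂ) * Q = 0 := by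
        push_cast
        rw [hu] at hx hx'
        linear_combination hx - hx'
      obtain ⟨c1, c2⟩ := coeffs_eq_zero hD e1
      have d1 : s = (t' - t) * m := by linarith
      refine ⟨t' / r, t / r, ⟨div_nonneg ht.1 hr.le, ?_, (div_le_one hr).2 ht'.2⟩, ?_⟩
      · have : 0 ≤ (t' - t) * m := d1 ▸ hs.1
        have : 0 ≤ t' - t := nonneg_of_mul_nonneg_left this hm
        gcongr
        linarith
      · have hr' : (r : ℂ) ≠ 0 := by exact_mod_cast hr.ne'
        have d1' : (s : ℂ) = (t' - t) * m := by exact_mod_cast d1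
        push_cast
        field_simp
        rw [hu, d1'] at hx
        linear_combination hx
    · rintro ⟨a, b, ⟨hb, hba, ha⟩, rfl⟩
      refine ⟨⟨b * r, ⟨by positivity, by nlinarith⟩, (a - b) * (r * m), ⟨?_, ?_⟩, ?_⟩,
        ⟨a * r, ⟨mul_nonneg (hb.trans hba) hr.le, by nlinarith⟩, (a - b) * (r * k), ⟨?_, ?_⟩, ?_⟩⟩
      · have := sub_nonneg.2 hba; positivity
      · exact mul_le_one₀ (by linarith) (by positivity) hrm
      · rw [hu]; push_cast; ring
      · have := sub_nonneg.2 hba; positivity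
      · exact mul_le_one₀ (by linarith) (by positivity) hrk
      · rw [hu]; push_cast; ring
  rw [key, volume_image_frame, volume_unit_triangle, ← ENNReal.ofReal_mul (abs_nonneg _)]
  congr 1
  rw [cross_ofReal_mul_left, cross_ofReal_mul_right, abs_mul (r * m), abs_mul (-(r * k)), abs_neg,
    abs_of_pos (mul_pos hr hm), abs_of_pos (mul_pos hr hk)]
  ring

/-- If the direction `u` has coordinates of equal sign then needles meeting both sides of the wedge
pass through its apex, and these start in a null set. -/
lemma volume_sweep_inter_of_mul_pos {v P Q u : ℂ} {r m k : ℝ} (hr : 0 < r) (hmk : 0 < m * k)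
    (hD : cross P Q ≠ 0) (hu : u = (m : ℂ) * P + k * Q) :
    volume (sweep r u (segment ℝ v (v + P)) ∩ sweep r u (segment ℝ v (v + Q))) = 0 := by
  refine measure_mono_null ?_ (volume_sweep_singleton hr u v)
  simp only [sweep, segment_eq_image', Complex.real_smul, add_sub_cancel_left]
  rintro x ⟨⟨t, ht, s, hs, hx⟩, ⟨t', ht', s', hs', hx'⟩⟩
  simp only at hx hx'
  have e1 : ((s + (t' - t) * m : ℝ) : ℂ) * P + ((-s' + (t' - t) * k : ℝ) : ℂ) * Q = 0 := by
    push_cast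
    rw [hu] at hx hx'
    linear_combination hx - hx'
  obtain ⟨c1, c2⟩ := coeffs_eq_zero hD e1
  have d1 : s = -((t' - t) * m) := by linarith
  have d2 : s' = (t' - t) * k := by linarith
  have hprod : s * s' = -((t' - t) ^ 2 * (m * k)) := by rw [d1, d2]; ring
  have h0 : (t' - t) ^ 2 * (m * k) = 0 := by
    have : 0 ≤ s * s' := mul_nonneg hs.1 hs'.1
    have : 0 ≤ (t' - t) ^ 2 * (m * k) := by positivity
    linarith
  have htt : t' - t = 0 := by
    have := (mul_eq_zero.1 h0).resolve_right hmk.ne'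
    exact pow_eq_zero_iff (two_ne_zero) |>.1 this
  have hs0 : s = 0 := by rw [d1, htt]; ring
  refine ⟨t, ht, ?_⟩
  rw [← hx, hs0]; simp

/-- The area of the set of starting points of the needles in direction `u` that bridge a wedge,
provided that they are too short to reach beyond the ends of its sides. -/
lemma volume_sweep_inter {v P Q u : ℂ} {r : ℝ} (hr : 0 < r) (hD : cross P Q ≠ 0)
    (hP : cross P u ≠ 0) (hQ : cross Q u ≠ 0) (hrP : r * |cross P u| ≤ |cross P Q|)
    (hrQ : r * |cross Q u| ≤ |cross P Q|) :
    volume (sweep r u (segment ℝ v (v + P)) ∩ sweep r u (segment ℝ v (v + Q)))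
      = ENNReal.ofReal (r ^ 2 / 2 * (max 0 (cross P u * cross Q u) / |cross P Q|)) := by
  have hu := eq_add_of_cross_ne_zero hD u
  have hDp : 0 < |cross P Q| := abs_pos.2 hD
  rw [cross_swap u Q] at hu
  have hsq : |cross P Q| * |cross P Q| = cross P Q * cross P Q := abs_mul_abs_self _
  set D := cross P Q with hDdef
  set p := cross P u
  set q := cross Q u
  have aux : ∀ x : ℝ, r * |x| ≤ |D| → r * |x / D| ≤ 1 := by
    intro x hx
    rw [abs_div, ← mul_div_assoc]
    exact (div_le_one hDp).2 hx
  have hsgn : (-q / D) * (p / D) = -(p * q) / (D * D) := by field_simp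
  have hDD : 0 < D * D := by rw [← hsq]; positivity
  rcases lt_or_gt_of_ne (mul_ne_zero hP hQ) with hneg | hpos
  · rw [max_eq_left hneg.le]
    rw [volume_sweep_inter_of_mul_pos hr (m := -q / D) (k := p / D) ?_ hD hu]
    · simp
    · rw [hsgn]; apply div_pos <;> linarith
  · rw [max_eq_right hpos.le]
    have hprod : (-q / D) * (p / D) < 0 := by
      rw [hsgn]; apply div_neg_of_neg_of_pos <;> linarith
    have aP := aux p hrP
    have aQ := aux q hrQ
    rcases mul_neg_iff.1 hprod with ⟨h1, h2⟩ | ⟨h1, h2⟩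
    · rw [inter_comm, volume_sweep_inter_of_pos hr (m := -(p / D)) (k := -q / D) (by linarith) h1
        (by rw [cross_swap]; exact neg_ne_zero.2 hD) (by rw [hu]; push_cast; ring)
        (by rwa [abs_of_neg h2] at aP)
        (by rwa [← abs_neg, ← neg_div, abs_of_pos h1] at aQ)]
      congr 2
      rw [cross_swap, abs_neg, ← hDdef, eq_div_iff hDp.ne', mul_assoc, hsq]
      field_simp
    · rw [volume_sweep_inter_of_pos hr (m := q / D) (k := p / D)
        (by rw [neg_div] at h1; linarith) h2 hD (by rw [hu]; push_cast; ring)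
        (by rw [neg_div] at h1; rwa [abs_of_pos (by linarith)] at aQ)
        (by rwa [abs_of_pos h2] at aP)]
      congr 2
      rw [← hDdef, eq_div_iff hDp.ne', mul_assoc, hsq]
      field_simp

/-! ### Averages over all directions -/

/-- The unit vector with direction `θ`. -/
def dir (θ : ℝ) : ℂ := Complex.exp (θ * Complex.I)

@[simp] lemma dir_re (θ : ℝ) : (dir θ).re = Real.cos θ := by
  simp [dir, Complex.exp_ofReal_mul_I_re]

@[simp] lemma dir_im (θ : ℝ) : (dir θ).im = Real.sin θ := by
  simp [dir, Complex.exp_ofReal_mul_I_im]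

@[fun_prop] lemma continuous_dir : Continuous dir := by unfold dir; fun_prop

@[simp] lemma norm_dir (θ : ℝ) : ‖dir θ‖ = 1 := Complex.norm_exp_ofReal_mul_I θ

lemma cross_dir_dir (α θ : ℝ) : cross (dir α) (dir θ) = Real.sin (θ - α) := by
  simp only [cross, dir_re, dir_im, Real.sin_sub]; ring

lemma exists_eq_norm_mul_dir (P : ℂ) : ∃ α : ℝ, P = (‖P‖ : ℝ) * dir α :=
  ⟨P.arg, by rw [dir, Complex.norm_mul_exp_arg_mul_I]⟩

lemma cross_dir_eq {P : ℂ} {α : ℝ} (h : P = (‖P‖ : ℝ) * dir α) (θ : ℝ) :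
    cross P (dir θ) = ‖P‖ * Real.sin (θ - α) := by
  conv_lhs => rw [h]
  rw [cross_ofReal_mul_left, cross_dir_dir]

/-- A function of the direction has the same mean after a rotation. -/
lemma integral_comp_sub_of_periodic {f : ℝ → ℝ} (hf : Function.Periodic f (2 * Real.pi)) (α : ℝ) :
    ∫ θ in (0 : ℝ)..(2 * Real.pi), f (θ - α) = ∫ θ in (0 : ℝ)..(2 * Real.pi), f θ := by
  rw [intervalIntegral.integral_comp_sub_right, zero_sub, sub_eq_neg_add,
    hf.intervalIntegral_add_eq (-α) 0, zero_add]

lemma integral_two_pi_eq_add {f : ℝ → ℝ} (hf : Continuous f) :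
    ∫ θ in (0 : ℝ)..(2 * Real.pi), f θ
      = (∫ θ in (0 : ℝ)..Real.pi, f θ) + ∫ θ in (0 : ℝ)..Real.pi, f (θ + Real.pi) := by
  rw [intervalIntegral.integral_comp_add_right, zero_add, ← two_mul,
    intervalIntegral.integral_add_adjacent_intervals (hf.intervalIntegrable _ _)
      (hf.intervalIntegrable _ _)]

lemma integral_abs_sin : ∫ θ in (0 : ℝ)..(2 * Real.pi), |Real.sin θ| = 4 := by
  have h : ∫ θ in (0 : ℝ)..Real.pi, |Real.sin θ| = 2 := by
    rw [show (2 : ℝ) = ∫ θ in (0 : ℝ)..Real.pi, Real.sin θ by rw [integral_sin]; norm_num]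
    refine intervalIntegral.integral_congr fun θ hθ => ?_
    rw [uIcc_of_le Real.pi_pos.le] at hθ
    exact abs_of_nonneg (Real.sin_nonneg_of_mem_Icc hθ)
  rw [integral_two_pi_eq_add (by fun_prop)]
  simp only [Real.sin_add_pi, abs_neg, h]
  norm_num

/-- Cauchy's formula for a segment: the integral of its width over all directions. -/
lemma integral_abs_cross_dir (P : ℂ) :
    ∫ θ in (0 : ℝ)..(2 * Real.pi), |cross P (dir θ)| = 4 * ‖P‖ := by
  obtain ⟨α, hα⟩ := exists_eq_norm_mul_dir P
  simp_rw [cross_dir_eq hα, abs_mul, abs_norm]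
  rw [intervalIntegral.integral_const_mul,
    integral_comp_sub_of_periodic (f := fun θ => |Real.sin θ|)
      (fun θ => by simp only [Real.sin_add_two_pi]), integral_abs_sin]
  ring

lemma integral_sin_mul_sin_sub (ψ : ℝ) :
    ∫ θ in ψ..Real.pi, Real.sin θ * Real.sin (θ - ψ)
      = ((Real.pi - ψ) * Real.cos ψ + Real.sin ψ) / 2 := by
  have hd : ∀ θ ∈ uIcc ψ Real.pi,
      HasDerivAt (fun θ => (θ * Real.cos ψ - Real.sin (2 * θ - ψ) / 2) / 2)
        (Real.sin θ * Real.sin (θ - ψ)) θ := by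
    intro θ _
    have h1 : HasDerivAt (fun θ : ℝ => 2 * θ - ψ) 2 θ := by
      simpa using ((hasDerivAt_id θ).const_mul 2).sub_const ψ
    have h2 := (((hasDerivAt_id θ).mul_const (Real.cos ψ)).sub (h1.sin.div_const 2)).div_const 2
    have e1 : Real.cos (2 * θ - ψ)
        = Real.cos θ * Real.cos (θ - ψ) - Real.sin θ * Real.sin (θ - ψ) := by
      rw [← Real.cos_add]; congr 1; ring
    have e2 : Real.cos ψ = Real.cos θ * Real.cos (θ - ψ) + Real.sin θ * Real.sin (θ - ψ) := by
      rw [← Real.cos_sub]; congr 1; ring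
    refine h2.congr_deriv ?_
    rw [e1, one_mul]
    nth_rewrite 1 [e2]
    ring
  rw [intervalIntegral.integral_eq_sub_of_hasDerivAt hd
    (Continuous.intervalIntegrable (by fun_prop) _ _)]
  rw [Real.sin_two_pi_sub, show 2 * ψ - ψ = ψ by ring]
  ring

lemma integral_max_sin_mul_sin_sub {ψ : ℝ} (h0 : 0 < ψ) (hπ : ψ < Real.pi) :
    ∫ θ in (0 : ℝ)..(2 * Real.pi), max 0 (Real.sin θ * Real.sin (θ - ψ))
      = (Real.pi - ψ) * Real.cos ψ + Real.sin ψ := by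
  have hc : Continuous fun θ => max 0 (Real.sin θ * Real.sin (θ - ψ)) := by fun_prop
  have h : ∫ θ in (0 : ℝ)..Real.pi, max 0 (Real.sin θ * Real.sin (θ - ψ))
      = ((Real.pi - ψ) * Real.cos ψ + Real.sin ψ) / 2 := by
    rw [← integral_sin_mul_sin_sub, ← intervalIntegral.integral_add_adjacent_intervals
      (hc.intervalIntegrable 0 ψ) (hc.intervalIntegrable ψ _)]
    have z : ∫ θ in (0 : ℝ)..ψ, max 0 (Real.sin θ * Real.sin (θ - ψ)) = 0 := by
      rw [intervalIntegral.integral_congr (g := fun _ => (0 : ℝ)) ?_]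
      · simp
      intro θ hθ
      rw [uIcc_of_le h0.le] at hθ
      have h1 : 0 ≤ Real.sin θ := Real.sin_nonneg_of_nonneg_of_le_pi hθ.1 (hθ.2.trans hπ.le)
      have h2 : Real.sin (θ - ψ) ≤ 0 :=
        Real.sin_nonpos_of_nonpos_of_neg_pi_le (by linarith [hθ.2]) (by linarith [hθ.1])
      exact max_eq_left (mul_nonpos_of_nonneg_of_nonpos h1 h2)
    rw [z, zero_add]
    refine intervalIntegral.integral_congr fun θ hθ => ?_
    rw [uIcc_of_le hπ.le] at hθ
    have h1 : 0 ≤ Real.sin θ := Real.sin_nonneg_of_nonneg_of_le_pi (h0.le.trans hθ.1) hθ.2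
    have h2 : 0 ≤ Real.sin (θ - ψ) :=
      Real.sin_nonneg_of_nonneg_of_le_pi (by linarith [hθ.1]) (by linarith [hθ.2])
    exact max_eq_right (mul_nonneg h1 h2)
  rw [integral_two_pi_eq_add hc]
  have e : ∀ θ : ℝ, Real.sin (θ + Real.pi) * Real.sin (θ + Real.pi - ψ)
      = Real.sin θ * Real.sin (θ - ψ) := fun θ => by
    rw [show θ + Real.pi - ψ = θ - ψ + Real.pi by ring, Real.sin_add_pi, Real.sin_add_pi]; ring
  simp only [e, h]
  ring

/-- Rotating a set of directions does not change its measure. -/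
lemma volume_real_setOf_sub {p : ℝ → Prop} (hp : Function.Periodic p (2 * Real.pi)) (α : ℝ)
    (hm : MeasurableSet {θ | p θ}) :
    volume.real {θ | θ ∈ Ico 0 (2 * Real.pi) ∧ p (θ - α)}
      = volume.real {θ | θ ∈ Ico 0 (2 * Real.pi) ∧ p θ} := by
  have key : ∀ q : ℝ → Prop, MeasurableSet {θ | q θ} →
      volume.real {θ | θ ∈ Ico 0 (2 * Real.pi) ∧ q θ}
        = ∫ θ in (0 : ℝ)..(2 * Real.pi), {θ | q θ}.indicator (fun _ => (1 : ℝ)) θ := by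
    intro q hq
    rw [intervalIntegral.integral_of_le (by positivity), ← integral_Ico_eq_integral_Ioc,
      setIntegral_indicator hq, setIntegral_const, smul_eq_mul, mul_one]
    rfl
  rw [key (fun θ => p (θ - α)) (hm.preimage (measurable_id.sub_const α)), key _ hm,
    ← integral_comp_sub_of_periodic (f := {θ | p θ}.indicator (fun _ => (1 : ℝ))) ?_ α]
  · rfl
  · intro θ
    have h := hp θ
    by_cases h' : p θ <;> simp [h, h']

lemma volume_real_half_circle {P : ℂ} (hP : P ≠ 0) :
    volume.real {θ : ℝ | θ ∈ Ico 0 (2 * Real.pi) ∧ 0 ≤ cross P (dir θ)} = Real.pi := by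
  obtain ⟨α, hα⟩ := exists_eq_norm_mul_dir P
  have hn : 0 < ‖P‖ := norm_pos_iff.2 hP
  simp_rw [cross_dir_eq hα, mul_nonneg_iff_of_pos_left hn]
  rw [volume_real_setOf_sub (p := fun θ => 0 ≤ Real.sin θ)
    (fun θ => by simp only [Real.sin_add_two_pi]) _
    (measurableSet_le measurable_const Real.measurable_sin)]
  have : {θ : ℝ | θ ∈ Ico 0 (2 * Real.pi) ∧ 0 ≤ Real.sin θ} = Icc 0 Real.pi := by
    ext θ
    simp only [mem_ofPred_eq, mem_Ico, mem_Icc]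
    constructor
    · rintro ⟨⟨h1, h2⟩, h3⟩
      refine ⟨h1, ?_⟩
      by_contra! h
      have := Real.sin_neg_of_neg_of_neg_pi_lt (x := θ - 2 * Real.pi) (by linarith) (by linarith)
      rw [Real.sin_sub_two_pi] at this
      linarith
    · rintro ⟨h1, h2⟩
      exact ⟨⟨h1, by linarith [Real.pi_pos]⟩, Real.sin_nonneg_of_nonneg_of_le_pi h1 h2⟩
  rw [this, measureReal_def, Real.volume_Icc, sub_zero, ENNReal.toReal_ofReal Real.pi_pos.le]

lemma volume_real_sector {ψ : ℝ} (h0 : 0 < ψ) (hπ : ψ < Real.pi) :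
    volume.real {θ : ℝ | θ ∈ Ico 0 (2 * Real.pi) ∧ (0 < Real.sin θ ∧ Real.sin (θ - ψ) < 0)} = ψ := by
  have : {θ : ℝ | θ ∈ Ico 0 (2 * Real.pi) ∧ (0 < Real.sin θ ∧ Real.sin (θ - ψ) < 0)} = Ioo 0 ψ := by
    ext θ
    simp only [mem_ofPred_eq, mem_Ico, mem_Ioo]
    constructor
    · rintro ⟨⟨h1, h2⟩, h3, h4⟩
      have hlt : θ < Real.pi := by
        by_contra! h
        have := Real.sin_nonpos_of_nonpos_of_neg_pi_le (x := θ - 2 * Real.pi)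
          (by linarith) (by linarith)
        rw [Real.sin_sub_two_pi] at this
        linarith
      constructor
      · rcases h1.eq_or_lt with h | h
        · rw [← h, Real.sin_zero] at h3; exact absurd h3 (lt_irrefl _)
        · exact h
      · by_contra! h
        have := Real.sin_nonneg_of_nonneg_of_le_pi (x := θ - ψ) (by linarith) (by linarith)
        linarith
    · rintro ⟨h1, h2⟩
      exact ⟨⟨h1.le, by linarith [Real.pi_pos]⟩,
        Real.sin_pos_of_pos_of_lt_pi h1 (by linarith),
        Real.sin_neg_of_neg_of_neg_pi_lt (by linarith) (by linarith)⟩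
  rw [this, measureReal_def, Real.volume_Ioo, sub_zero, ENNReal.toReal_ofReal h0.le]

/-- Polar form of a positively oriented pair of vectors, with the angle `ψ` between them. -/
lemma exists_angle_of_cross_pos {P Q : ℂ} (h : 0 < cross P Q) :
    ∃ α ψ : ℝ, 0 < ψ ∧ ψ < Real.pi ∧ P = (‖P‖ : ℝ) * dir α ∧ Q = (‖Q‖ : ℝ) * dir (α + ψ) := by
  have hP : P ≠ 0 := by rintro rfl; simp at h
  have hQ : Q ≠ 0 := by rintro rfl; simp at h
  have hPn : (‖P‖ : ℂ) ≠ 0 := by exact_mod_cast norm_ne_zero_iff.2 hP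
  have him : 0 < (Q / P).im := by
    rw [Complex.div_im]
    have := Complex.normSq_pos.2 hP
    rw [← sub_div]
    apply div_pos _ this
    simp only [cross] at h
    linarith
  refine ⟨P.arg, (Q / P).arg, ?_, ?_, ?_, ?_⟩
  · have h0 := Complex.arg_nonneg_iff.2 him.le
    refine lt_of_le_of_ne h0 fun h1 => ?_
    rw [eq_comm, Complex.arg_eq_zero_iff] at h1
    exact him.ne' h1.2
  · refine lt_of_le_of_ne (Complex.arg_le_pi _) fun h1 => ?_
    rw [Complex.arg_eq_pi_iff] at h1
    exact him.ne' h1.2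
  · rw [dir, Complex.norm_mul_exp_arg_mul_I]
  · have e1 := Complex.norm_mul_exp_arg_mul_I P
    have e2 := Complex.norm_mul_exp_arg_mul_I (Q / P)
    have e3 : Q = Q / P * P := by field_simp
    rw [norm_div, Complex.ofReal_div] at e2
    rw [dir, Complex.ofReal_add, add_mul, Complex.exp_add]
    calc Q = (‖Q‖ / ‖P‖ * Complex.exp ((Q / P).arg * Complex.I)) *
          (‖P‖ * Complex.exp (P.arg * Complex.I)) := by rw [e2, e1]; exact e3
      _ = _ := by
        generalize Complex.exp ((Q / P).arg * Complex.I) = B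
        generalize Complex.exp (P.arg * Complex.I) = A
        field_simp

/-- The angle `ψ` of a wedge, as the measure of a set of directions, and the integral over all
directions of the area of the triangles of `volume_sweep_inter` (up to the factor `r ^ 2 / 2`).
For `ψ = π / 2` the convention `Real.tan ψ = 0`, `x / 0 = 0` gives the correct value `1`. -/
lemma exists_wedge_angle {P Q : ℂ} (h : cross P Q ≠ 0) :
    ∃ ψ : ℝ, 0 < ψ ∧ ψ < Real.pi ∧
      volume.real {θ : ℝ | θ ∈ Ico 0 (2 * Real.pi) ∧
        (0 < cross (dir θ) Q / cross P Q ∧ 0 < cross P (dir θ) / cross P Q)} = ψ ∧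
      ∫ θ in (0 : ℝ)..(2 * Real.pi), max 0 (cross P (dir θ) * cross Q (dir θ)) / |cross P Q|
        = (Real.pi - ψ) / Real.tan ψ + 1 := by
  wlog hpos : 0 < cross P Q generalizing P Q
  · have hneg : 0 < cross Q P := by
      rw [cross_swap]; exact neg_pos.2 (lt_of_le_of_ne (not_lt.1 hpos) h)
    obtain ⟨ψ, h1, h2, h3, h4⟩ := this hneg.ne' hneg
    refine ⟨ψ, h1, h2, ?_, ?_⟩
    · rw [← h3]
      congr 1
      ext θ
      simp only [mem_ofPred_eq]
      rw [cross_swap (dir θ) Q, cross_swap P Q, cross_swap P (dir θ), neg_div_neg_eq,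
        neg_div_neg_eq]
      tauto
    · rw [← h4]
      simp_rw [cross_swap P Q, abs_neg, mul_comm (cross P _)]
  obtain ⟨α, ψ, h0, hπ, hP, hQ⟩ := exists_angle_of_cross_pos hpos
  have hPn : 0 < ‖P‖ := norm_pos_iff.2 (by rintro rfl; simp at h)
  have hQn : 0 < ‖Q‖ := norm_pos_iff.2 (by rintro rfl; simp at h)
  have hsin : 0 < Real.sin ψ := Real.sin_pos_of_pos_of_lt_pi h0 hπ
  have hPQ : cross P Q = ‖P‖ * ‖Q‖ * Real.sin ψ := by
    conv_lhs => rw [hQ]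
    rw [cross_ofReal_mul_right, cross_dir_eq hP, add_sub_cancel_left]; ring
  refine ⟨ψ, h0, hπ, ?_, ?_⟩
  · rw [← volume_real_sector h0 hπ, ← volume_real_setOf_sub
      (p := fun θ => 0 < Real.sin θ ∧ Real.sin (θ - ψ) < 0) ?_ α]
    · congr 1
      ext θ
      simp only [mem_ofPred_eq]
      rw [div_pos_iff_of_pos_right hpos, div_pos_iff_of_pos_right hpos, cross_swap (dir θ) Q,
        cross_dir_eq hP, cross_dir_eq hQ, Left.neg_pos_iff, ← sub_sub, mul_pos_iff_of_pos_left hPn,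
        ← smul_eq_mul ‖Q‖, smul_neg_iff_of_pos_left hQn, and_comm (a := Real.sin (θ - α - ψ) < 0)]
    · exact (measurableSet_lt measurable_const Real.measurable_sin).inter
        (measurableSet_lt (Real.measurable_sin.comp (measurable_id.sub_const ψ)) measurable_const)
    · intro θ
      simp only [Real.sin_add_two_pi, add_sub_right_comm]
  · have e : ∀ θ, max 0 (cross P (dir θ) * cross Q (dir θ)) / |cross P Q|
        = (1 / Real.sin ψ) * max 0 (Real.sin (θ - α) * Real.sin (θ - α - ψ)) := by
      intro θ
      rw [abs_of_pos hpos, hPQ, cross_dir_eq hP, cross_dir_eq hQ, ← sub_sub,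
        show ‖P‖ * Real.sin (θ - α) * (‖Q‖ * Real.sin (θ - α - ψ))
          = (‖P‖ * ‖Q‖) * (Real.sin (θ - α) * Real.sin (θ - α - ψ)) by ring,
        ← mul_zero (‖P‖ * ‖Q‖), ← mul_max_of_nonneg _ _ (by positivity), mul_zero]
      field_simp
    simp_rw [e]
    rw [intervalIntegral.integral_const_mul,
      integral_comp_sub_of_periodic (f := fun θ => max 0 (Real.sin θ * Real.sin (θ - ψ))) ?_,
      integral_max_sin_mul_sin_sub h0 hπ, Real.tan_eq_sin_div_cos, div_div_eq_mul_div, mul_add,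
      one_div_mul_cancel hsin.ne', one_div, inv_mul_eq_div]
    intro θ
    simp only [Real.sin_add_two_pi, add_sub_right_comm]

/-! ### Local shape of a regular closed set near its frontier -/

/-- The coordinate along `P` of a vector with respect to `P` and `Q`. -/
def coord (P Q : ℂ) : ℂ →ₗ[ℝ] ℝ where
  toFun w := cross w Q / cross P Q
  map_add' w w' := by rw [cross_add_left, add_div]
  map_smul' c w := by
    rw [Complex.real_smul, cross_ofReal_mul_left, RingHom.id_apply, smul_eq_mul, mul_div_assoc]

lemma coord_apply (P Q w : ℂ) : coord P Q w = cross w Q / cross P Q := rfl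

lemma coord_swap_apply (P Q w : ℂ) : coord Q P w = cross P w / cross P Q := by
  rw [coord_apply, cross_swap w P, cross_swap Q P, neg_div_neg_eq]

lemma eq_coord_add {P Q : ℂ} (h : cross P Q ≠ 0) (w : ℂ) :
    w = (coord P Q w : ℂ) * P + (coord Q P w : ℂ) * Q := by
  rw [coord_swap_apply P Q, coord_apply P Q]; exact eq_add_of_cross_ne_zero h w

lemma coord_combination {P Q : ℂ} (h : cross P Q ≠ 0) (a b : ℝ) :
    coord P Q (a * P + b * Q) = a := by
  rw [coord_apply, cross_add_left, cross_ofReal_mul_left, cross_ofReal_mul_left, cross_self,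
    mul_zero, add_zero, mul_div_cancel_right₀ _ h]

lemma cross_swap_ne_zero {P Q : ℂ} (h : cross P Q ≠ 0) : cross Q P ≠ 0 := by
  rw [cross_swap]; exact neg_ne_zero.2 h

/-- The linear functional `w ↦ cross d w`. -/
def crossLeft (d : ℂ) : ℂ →ₗ[ℝ] ℝ where
  toFun w := cross d w
  map_add' w w' := cross_add_right d w w'
  map_smul' c w := by
    rw [Complex.real_smul, cross_ofReal_mul_right, RingHom.id_apply, smul_eq_mul]

lemma convex_setOf_pos (f : ℂ →ₗ[ℝ] ℝ) (z : ℂ) : Convex ℝ {w | 0 < f (w - z)} := by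
  have : {w | 0 < f (w - z)} = (fun w => w + -z) ⁻¹' (f ⁻¹' Ioi 0) := by
    ext w; simp [sub_eq_add_neg]
  rw [this]
  exact ((convex_Ioi 0).linear_preimage f).translate_preimage_left _

lemma convex_setOf_neg (f : ℂ →ₗ[ℝ] ℝ) (z : ℂ) : Convex ℝ {w | f (w - z) < 0} := by
  have := convex_setOf_pos (-f) z
  simpa using this

lemma convex_setOf_nonneg (f : ℂ →ₗ[ℝ] ℝ) (z : ℂ) : Convex ℝ {w | 0 ≤ f (w - z)} := by
  have : {w | 0 ≤ f (w - z)} = (fun w => w + -z) ⁻¹' (f ⁻¹' Ici 0) := by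
    ext w; simp [sub_eq_add_neg]
  rw [this]
  exact ((convex_Ici 0).linear_preimage f).translate_preimage_left _

/-- A connected set which avoids the frontier of `S` is on one side of it. -/
lemma subset_or_disjoint_of_frontier {S U : Set ℂ} (hU : IsPreconnected U)
    (h : ∀ w ∈ U, w ∉ frontier S) : U ⊆ S ∨ ∀ w ∈ U, w ∉ S := by
  have hsub : U ⊆ interior S ∪ interior Sᶜ := by
    intro w hw
    by_contra hc
    rw [mem_union, not_or] at hc
    refine h w hw ?_
    rw [frontier_eq_closure_inter_closure, ← compl_compl (closure S), ← interior_compl,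
      ← compl_compl (closure Sᶜ), ← interior_compl, compl_compl S]
    exact ⟨hc.2, hc.1⟩
  have hd : Disjoint (interior S) (interior Sᶜ) :=
    (disjoint_compl_right (a := S)).mono interior_subset interior_subset
  rcases IsPreconnected.subset_or_subset isOpen_interior isOpen_interior hd hsub hU with h1 | h1
  · exact Or.inl (h1.trans interior_subset)
  · exact Or.inr fun w hw => interior_subset (h1 hw)

/-- If a ball about a frontier point of a regular closed set is cut by the frontier into two
connected pieces then one of them is inside, the other outside. -/
lemma inside_outside_of_pieces {S U₁ U₂ : Set ℂ} {z : ℂ} {δ : ℝ} (hδ : 0 < δ) (hS : IsClosed S)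
    (hreg : closure (interior S) = S) (hz : z ∈ frontier S)
    (h₁ : IsPreconnected U₁) (h₂ : IsPreconnected U₂)
    (hf₁ : ∀ w ∈ U₁, w ∉ frontier S) (hf₂ : ∀ w ∈ U₂, w ∉ frontier S)
    (hcov : ∀ w ∈ Metric.ball z δ, w ∉ frontier S → w ∈ U₁ ∨ w ∈ U₂) :
    (U₁ ⊆ S ∧ ∀ w ∈ U₂, w ∉ S) ∨ (U₂ ⊆ S ∧ ∀ w ∈ U₁, w ∉ S) := by
  rcases subset_or_disjoint_of_frontier h₁ hf₁ with a₁ | a₁ <;>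
    rcases subset_or_disjoint_of_frontier h₂ hf₂ with a₂ | a₂
  -- if both pieces are inside then `z` is an interior point
  · exfalso
    have hsub : Metric.ball z δ ⊆ S := by
      intro w hw
      by_cases hwf : w ∈ frontier S
      · exact hS.frontier_subset hwf
      · exact (hcov w hw hwf).elim (fun h => a₁ h) (fun h => a₂ h)
    exact hz.2 (interior_maximal hsub Metric.isOpen_ball (Metric.mem_ball_self hδ))
  · exact Or.inl ⟨a₁, a₂⟩
  · exact Or.inr ⟨a₂, a₁⟩
  -- if both are outside then `z` is not a limit of interior points
  · exfalso
    have hz' : z ∈ closure (interior S) := by rw [hreg]; exact hS.frontier_subset hz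
    obtain ⟨w, hw, hwd⟩ := Metric.mem_closure_iff.1 hz' δ hδ
    have hwf : w ∉ frontier S := fun h => h.2 hw
    rw [dist_comm] at hwd
    exact (hcov w hwd hwf).elim (fun h => a₁ w h (interior_subset hw))
      (fun h => a₂ w h (interior_subset hw))

/-- Near `z`, the set `S` is the half plane to the left of the line through `z` in
direction `d`. -/
def FlatAt (S : Set ℂ) (z d : ℂ) : Prop :=
  ∀ᶠ w in 𝓝 z, (w ∈ S ↔ 0 ≤ cross d (w - z)) ∧ (w ∈ frontier S ↔ cross d (w - z) = 0)

/-- Near `z`, the set `S` is the convex sector with apex `z` spanned by `P` and `Q`. -/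
def ConvexCornerAt (S : Set ℂ) (z P Q : ℂ) : Prop :=
  ∀ᶠ w in 𝓝 z, w ∈ S ↔ 0 ≤ coord P Q (w - z) ∧ 0 ≤ coord Q P (w - z)

/-- Near `z`, the set `S` is the complement of the open convex sector with apex `z` spanned by `P`
and `Q`. -/
def ReflexCornerAt (S : Set ℂ) (z P Q : ℂ) : Prop :=
  ∀ᶠ w in 𝓝 z, w ∈ S ↔ ¬ (0 < coord P Q (w - z) ∧ 0 < coord Q P (w - z))

lemma flatAt_or_flatAt_neg {S : Set ℂ} {z d : ℂ} (hS : IsClosed S)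
    (hreg : closure (interior S) = S)
    (hfr : ∀ᶠ w in 𝓝 z, w ∈ frontier S ↔ cross d (w - z) = 0) :
    FlatAt S z d ∨ FlatAt S z (-d) := by
  obtain ⟨δ, hδ, hb⟩ := Metric.eventually_nhds_iff_ball.1 hfr
  have hz : z ∈ frontier S := (hb z (Metric.mem_ball_self hδ)).2 (by simp)
  have hball := Metric.ball_mem_nhds z hδ
  have hconv := convex_ball z δ
  rcases inside_outside_of_pieces (U₁ := Metric.ball z δ ∩ {w | 0 < crossLeft d (w - z)})
      (U₂ := Metric.ball z δ ∩ {w | crossLeft d (w - z) < 0}) hδ hS hreg hz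
      (hconv.inter (convex_setOf_pos _ _)).isPreconnected
      (hconv.inter (convex_setOf_neg _ _)).isPreconnected
      (fun w hw h => hw.2.ne' ((hb w hw.1).1 h)) (fun w hw h => hw.2.ne ((hb w hw.1).1 h))
      (fun w hw h => by
        rw [hb w hw] at h
        rcases lt_or_gt_of_ne h with h' | h'
        · exact Or.inr ⟨hw, h'⟩
        · exact Or.inl ⟨hw, h'⟩) with ⟨h1, h2⟩ | ⟨h1, h2⟩
  · left
    filter_upwards [hball] with w hw
    refine ⟨⟨fun h => ?_, fun h => ?_⟩, hb w hw⟩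
    · by_contra! hc
      exact h2 w ⟨hw, hc⟩ h
    · rcases h.eq_or_lt with h' | h'
      · exact hS.frontier_subset ((hb w hw).2 h'.symm)
      · exact h1 ⟨hw, h'⟩
  · right
    filter_upwards [hball] with w hw
    rw [cross_neg_left, neg_eq_zero, neg_nonneg]
    refine ⟨⟨fun h => ?_, fun h => ?_⟩, hb w hw⟩
    · by_contra! hc
      exact h2 w ⟨hw, hc⟩ h
    · rcases h.eq_or_lt with h' | h'
      · exact hS.frontier_subset ((hb w hw).2 h')
      · exact h1 ⟨hw, h'⟩

lemma convexCornerAt_or_reflexCornerAt {S : Set ℂ} {z P Q : ℂ} (hS : IsClosed S)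
    (hreg : closure (interior S) = S) (hD : cross P Q ≠ 0)
    (hfr : ∀ᶠ w in 𝓝 z, w ∈ frontier S ↔
      (0 ≤ coord P Q (w - z) ∧ coord Q P (w - z) = 0) ∨
        (coord P Q (w - z) = 0 ∧ 0 ≤ coord Q P (w - z))) :
    ConvexCornerAt S z P Q ∨ ReflexCornerAt S z P Q := by
  obtain ⟨δ, hδ, hb⟩ := Metric.eventually_nhds_iff_ball.1 hfr
  have hz : z ∈ frontier S := (hb z (Metric.mem_ball_self hδ)).2 (by simp)
  have hball := Metric.ball_mem_nhds z hδ
  have hconv := convex_ball z δ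
  -- the outer piece is a union of two half discs with a common point
  have hcommon : ∃ w ∈ Metric.ball z δ, coord P Q (w - z) < 0 ∧ coord Q P (w - z) < 0 := by
    have ht : Tendsto (fun t : ℝ => z - t * (P + Q)) (𝓝[>] 0) (𝓝 z) := by
      have : Continuous (fun t : ℝ => z - t * (P + Q)) := by fun_prop
      have := this.tendsto 0
      simp only [Complex.ofReal_zero, zero_mul, sub_zero] at this
      exact this.mono_left nhdsWithin_le_nhds
    obtain ⟨t, ht1, ht2⟩ := ((ht.eventually hball).and self_mem_nhdsWithin).exists
    have ht2 : 0 < t := ht2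
    refine ⟨_, ht1, ?_, ?_⟩
    · have := coord_combination hD (-t) (-t)
      rw [show z - t * (P + Q) - z = ((-t : ℝ) : ℂ) * P + ((-t : ℝ) : ℂ) * Q by push_cast; ring]
      linarith
    · have := coord_combination (cross_swap_ne_zero hD) (-t) (-t)
      rw [show z - t * (P + Q) - z = ((-t : ℝ) : ℂ) * Q + ((-t : ℝ) : ℂ) * P by push_cast; ring]
      linarith
  obtain ⟨w₀, hw₀, hw₁, hw₂⟩ := hcommon
  rcases inside_outside_of_pieces
      (U₁ := Metric.ball z δ ∩ ({w | 0 < coord P Q (w - z)} ∩ {w | 0 < coord Q P (w - z)}))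
      (U₂ := (Metric.ball z δ ∩ {w | coord P Q (w - z) < 0}) ∪
        (Metric.ball z δ ∩ {w | coord Q P (w - z) < 0})) hδ hS hreg hz
      (hconv.inter ((convex_setOf_pos _ _).inter (convex_setOf_pos _ _))).isPreconnected
      (IsPreconnected.union w₀ ⟨hw₀, hw₁⟩ ⟨hw₀, hw₂⟩
        (hconv.inter (convex_setOf_neg _ _)).isPreconnected
        (hconv.inter (convex_setOf_neg _ _)).isPreconnected)
      (fun w hw h => by
        have h1 : 0 < coord P Q (w - z) := hw.2.1
        have h2 : 0 < coord Q P (w - z) := hw.2.2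
        rcases (hb w hw.1).1 h with h | h <;> linarith [h.1, h.2])
      (fun w hw h => by
        rcases hw with ⟨hw, h1⟩ | ⟨hw, h1⟩ <;> rw [mem_ofPred_eq] at h1 <;>
        rcases (hb w hw).1 h with h | h <;> linarith [h.1, h.2])
      (fun w hw h => by
        rw [hb w hw] at h
        by_cases c1 : coord P Q (w - z) < 0
        · exact Or.inr (Or.inl ⟨hw, c1⟩)
        by_cases c2 : coord Q P (w - z) < 0
        · exact Or.inr (Or.inr ⟨hw, c2⟩)
        push Not at c1 c2 h
        refine Or.inl ⟨hw, lt_of_le_of_ne c1 fun e => ?_, lt_of_le_of_ne c2 fun e => ?_⟩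
        · linarith [h.2 e.symm]
        · exact h.1 c1 e.symm) with ⟨h1, h2⟩ | ⟨h1, h2⟩
  · left
    filter_upwards [hball] with w hw
    constructor
    · intro h
      constructor <;> by_contra! hc
      · exact h2 w (Or.inl ⟨hw, hc⟩) h
      · exact h2 w (Or.inr ⟨hw, hc⟩) h
    · rintro ⟨c1, c2⟩
      by_cases hwf : w ∈ frontier S
      · exact hS.frontier_subset hwf
      · rw [hb w hw] at hwf
        push Not at hwf
        refine h1 ⟨hw, lt_of_le_of_ne c1 fun e => ?_, lt_of_le_of_ne c2 fun e => ?_⟩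
        · linarith [hwf.2 e.symm]
        · exact hwf.1 c1 e.symm
  · right
    filter_upwards [hball] with w hw
    constructor
    · exact fun h hc => h2 w ⟨hw, hc⟩ h
    · intro hc
      by_cases hwf : w ∈ frontier S
      · exact hS.frontier_subset hwf
      · rw [hb w hw] at hwf
        push Not at hwf
        apply h1
        by_cases c1 : coord P Q (w - z) < 0
        · exact Or.inl ⟨hw, c1⟩
        by_cases c2 : coord Q P (w - z) < 0
        · exact Or.inr ⟨hw, c2⟩
        push Not at c1 c2
        refine absurd ⟨lt_of_le_of_ne c1 fun e => ?_, lt_of_le_of_ne c2 fun e => ?_⟩ hc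
        · linarith [hwf.2 e.symm]
        · exact hwf.1 c1 e.symm

/-- Near its endpoint a segment is a ray. -/
lemma eventually_mem_segment_iff {P Q : ℂ} (hD : cross P Q ≠ 0) (z : ℂ) :
    ∀ᶠ w in 𝓝 z, w ∈ segment ℝ z (z + P) ↔ 0 ≤ coord P Q (w - z) ∧ coord Q P (w - z) = 0 := by
  have hc : Continuous fun w => coord P Q (w - z) :=
    (coord P Q).continuous_of_finiteDimensional.comp (continuous_id.sub continuous_const)
  have h1 : ∀ᶠ w in 𝓝 z, coord P Q (w - z) < 1 :=
    (hc.tendsto z).eventually_lt_const (by simp)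
  filter_upwards [h1] with w hw
  rw [segment_eq_image', mem_image]
  simp only [Complex.real_smul, add_sub_cancel_left]
  constructor
  · rintro ⟨s, hs, rfl⟩
    have e : z + s * P - z = (s : ℂ) * P + ((0 : ℝ) : ℂ) * Q := by push_cast; ring
    have e' : z + s * P - z = ((0 : ℝ) : ℂ) * Q + (s : ℂ) * P := by push_cast; ring
    refine ⟨?_, ?_⟩
    · rw [e, coord_combination hD]; exact hs.1
    · rw [e', coord_combination (cross_swap_ne_zero hD)]
  · rintro ⟨h0, h2⟩
    refine ⟨_, ⟨h0, hw.le⟩, ?_⟩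
    have := eq_coord_add hD (w - z)
    rw [h2, Complex.ofReal_zero, zero_mul, add_zero] at this
    rw [← this]; ring

/-- Two opposite segments form a line near their common endpoint. -/
lemma eventually_mem_segment_or_iff {P : ℂ} (hP : P ≠ 0) {c : ℝ} (hc : c < 0) (z : ℂ) :
    ∀ᶠ w in 𝓝 z, (w ∈ segment ℝ z (z + P) ∨ w ∈ segment ℝ z (z + c * P)) ↔
      cross P (w - z) = 0 := by
  have hPn : 0 < ‖P‖ := norm_pos_iff.2 hP
  have hpos : 0 < min 1 (-c) * ‖P‖ := mul_pos (lt_min one_pos (by linarith)) hPn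
  filter_upwards [Metric.ball_mem_nhds z hpos] with w hw
  rw [segment_eq_image', segment_eq_image', mem_image, mem_image]
  simp only [Complex.real_smul, add_sub_cancel_left]
  constructor
  · rintro (⟨s, hs, rfl⟩ | ⟨s, hs, rfl⟩)
    · simp
    · simp
  · intro h
    obtain ⟨s, hs⟩ := exists_eq_mul_of_cross_eq_zero hP h
    rw [Metric.mem_ball, dist_eq_norm, hs, norm_mul, Complex.norm_real, Real.norm_eq_abs] at hw
    have hlt := lt_of_mul_lt_mul_right hw hPn.le
    have e : w = z + s * P := by rw [← hs]; ring
    rcases le_or_gt 0 s with h0 | h0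
    · rw [abs_of_nonneg h0] at hlt
      exact Or.inl ⟨s, ⟨h0, (hlt.trans_le (min_le_left _ _)).le⟩, e.symm⟩
    · rw [abs_of_neg h0] at hlt
      refine Or.inr ⟨s / c, ⟨div_nonneg_of_nonpos h0.le hc.le, ?_⟩, ?_⟩
      · have := hlt.trans_le (min_le_right _ _)
        rw [div_le_one_of_neg hc]
        linarith
      · have : (c : ℂ) ≠ 0 := by exact_mod_cast hc.ne
        rw [e]; push_cast; field_simp

lemma segment_eq_union {a b z : ℂ} (hz : z ∈ segment ℝ a b) :
    segment ℝ a b = segment ℝ z a ∪ segment ℝ z b := by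
  rw [segment_eq_image_lineMap] at hz
  obtain ⟨s, hs, rfl⟩ := hz
  have h := fun x y : ℝ => image_segment ℝ (AffineMap.lineMap a b : ℝ →ᵃ[ℝ] ℂ) x y
  have h1 := h 0 1
  have h2 := h s 0
  have h3 := h s 1
  simp only [AffineMap.lineMap_apply_zero, AffineMap.lineMap_apply_one] at h1 h2 h3
  rw [← h1, ← h2, ← h3, ← image_union, segment_symm ℝ s 0, segment_eq_Icc hs.1,
    segment_eq_Icc hs.2, segment_eq_Icc zero_le_one, Icc_union_Icc_eq_Icc hs.1 hs.2]

namespace Target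

/-! ### Combinatorics of the outline -/

variable (T : Target)

/-- The cyclic successor of a vertex. -/
abbrev next (i : Fin T.n) : Fin T.n := finRotate T.n i

/-- The `i`-th edge, from the `i`-th vertex to its successor. -/
def edge (i : Fin T.n) : Set ℂ := segment ℝ (T.outline i) (T.outline (T.next i))

/-- The vector along the `i`-th edge. -/
def edgeVec (i : Fin T.n) : ℂ := T.outline (T.next i) - T.outline i

lemma edgeSet_eq_edge (i : Fin T.n) : T.outline.edgeSet ℝ i = T.edge i := by
  rw [Polygon.edgeSet, affineSegment_eq_segment, edge]

lemma mem_frontier_iff {w : ℂ} : w ∈ frontier T.region ↔ ∃ i, w ∈ T.edge i := by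
  rw [T.frontier_eq, Polygon.boundary, mem_iUnion]
  simp_rw [edgeSet_eq_edge]

lemma isClosed_region : IsClosed T.region := T.isCompact.isClosed

lemma isClosed_edge (i : Fin T.n) : IsClosed (T.edge i) := (isCompact_segment _ _).isClosed

lemma next_ne_self (i : Fin T.n) : T.next i ≠ i := by
  have h3 := T.three_le
  have := i.neZero
  rw [next, finRotate_apply, Ne, Fin.ext_iff, Fin.val_add, Fin.val_one']
  have hi := i.isLt
  rw [Nat.mod_eq_of_lt (by omega : 1 < T.n)]
  rcases Nat.lt_or_ge (i + 1) T.n with h | h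
  · rw [Nat.mod_eq_of_lt h]; omega
  · rw [show (i : ℕ) + 1 = T.n by omega, Nat.mod_self]; omega

lemma next_next_ne_self (i : Fin T.n) : T.next (T.next i) ≠ i := by
  have h3 := T.three_le
  have := i.neZero
  rw [next, next, finRotate_apply, finRotate_apply, Ne, Fin.ext_iff, Fin.val_add, Fin.val_add,
    Fin.val_one']
  have hi := i.isLt
  rw [Nat.mod_eq_of_lt (by omega : 1 < T.n)]
  rcases Nat.lt_or_ge (i + 1) T.n with h | h
  · rw [Nat.mod_eq_of_lt h]
    rcases Nat.lt_or_ge (i + 1 + 1) T.n with h' | h'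
    · rw [Nat.mod_eq_of_lt h']; omega
    · rw [show (i : ℕ) + 1 + 1 = T.n by omega, Nat.mod_self]; omega
  · rw [show (i : ℕ) + 1 = T.n by omega, Nat.mod_self, zero_add, Nat.mod_eq_of_lt (by omega)]; omega

lemma outline_injective : Function.Injective T.outline.vertices := T.simple.1

lemma edgeVec_ne_zero (i : Fin T.n) : T.edgeVec i ≠ 0 :=
  sub_ne_zero.2 (T.outline_injective.ne (T.next_ne_self i))

lemma edge_inter {i j : Fin T.n} (h : i ≠ j) {z : ℂ} (hi : z ∈ T.edge i) (hj : z ∈ T.edge j) :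
    (j = T.next i ∧ z = T.outline j) ∨ (i = T.next j ∧ z = T.outline i) := by
  rw [← edgeSet_eq_edge] at hi hj
  exact T.simple.2 i j h z ⟨hi, hj⟩

lemma edge_unique {i j : Fin T.n} {z : ℂ} (hz : ∀ k, z ≠ T.outline k) (hi : z ∈ T.edge i)
    (hj : z ∈ T.edge j) : i = j := by
  by_contra h
  rcases T.edge_inter h hi hj with h' | h'
  · exact hz _ h'.2
  · exact hz _ h'.2

lemma left_mem_edge (i : Fin T.n) : T.outline i ∈ T.edge i := left_mem_segment _ _ _

lemma right_mem_edge (i : Fin T.n) : T.outline (T.next i) ∈ T.edge i := right_mem_segment _ _ _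

lemma eq_or_eq_next_of_mem_edge {i j : Fin T.n} (h : T.outline (T.next i) ∈ T.edge j) :
    j = i ∨ j = T.next i := by
  by_contra! hc
  rcases T.edge_inter hc.1.symm (T.right_mem_edge i) h with h' | h'
  · exact hc.2 h'.1
  · exact T.next_ne_self i (T.outline_injective h'.2)

lemma edge_inter_edge_next {i : Fin T.n} {z : ℂ} (h : z ∈ T.edge i) (h' : z ∈ T.edge (T.next i)) :
    z = T.outline (T.next i) := by
  rcases T.edge_inter (T.next_ne_self i).symm h h' with h'' | h''
  · exact h''.2
  · exact absurd h''.1.symm (T.next_next_ne_self i)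

/-- Near a point only those edges are seen which contain it. -/
lemma eventually_mem_edge (z : ℂ) : ∀ᶠ w in 𝓝 z, ∀ j, w ∈ T.edge j → z ∈ T.edge j := by
  rw [eventually_all]
  intro j
  by_cases h : z ∈ T.edge j
  · exact Eventually.of_forall fun _ _ => h
  · filter_upwards [(T.isClosed_edge j).isOpen_compl.mem_nhds h] with w hw hw'
    exact absurd hw' hw

/-! ### The local shape of a target -/

/-- The vector from the vertex `next i` back along the `i`-th edge. -/
def backVec (i : Fin T.n) : ℂ := -T.edgeVec i

/-- The vector from the vertex `next i` along its other edge. -/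
def foreVec (i : Fin T.n) : ℂ := T.edgeVec (T.next i)

lemma edge_eq_back (i : Fin T.n) :
    T.edge i = segment ℝ (T.outline (T.next i)) (T.outline (T.next i) + T.backVec i) := by
  rw [segment_symm, edge]; simp [backVec, edgeVec]

lemma edge_next_eq_fore (i : Fin T.n) : T.edge (T.next i)
    = segment ℝ (T.outline (T.next i)) (T.outline (T.next i) + T.foreVec i) := by
  rw [edge]; simp [foreVec, edgeVec]

/-- The edges near the vertex `next i`, in the coordinates given by its two edge vectors. -/
def CornerEdgesAt (i : Fin T.n) : Prop :=
  ∀ᶠ w in 𝓝 (T.outline (T.next i)),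
    (w ∈ T.edge i ↔ 0 ≤ coord (T.backVec i) (T.foreVec i) (w - T.outline (T.next i)) ∧
      coord (T.foreVec i) (T.backVec i) (w - T.outline (T.next i)) = 0) ∧
    (w ∈ T.edge (T.next i) ↔ coord (T.backVec i) (T.foreVec i) (w - T.outline (T.next i)) = 0 ∧
      0 ≤ coord (T.foreVec i) (T.backVec i) (w - T.outline (T.next i))) ∧
    ∀ j, w ∈ T.edge j → j = i ∨ j = T.next i

lemma cornerEdgesAt {i : Fin T.n} (hD : cross (T.backVec i) (T.foreVec i) ≠ 0) :
    T.CornerEdgesAt i := by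
  filter_upwards [eventually_mem_segment_iff hD (T.outline (T.next i)),
    eventually_mem_segment_iff (cross_swap_ne_zero hD) (T.outline (T.next i)),
    T.eventually_mem_edge (T.outline (T.next i))] with w h1 h2 h3
  rw [edge_eq_back, edge_next_eq_fore]
  exact ⟨h1, by rw [h2, and_comm], fun j hj => T.eq_or_eq_next_of_mem_edge (h3 j hj)⟩

/-- Consecutive edges that are parallel point in opposite directions from their vertex. -/
lemma exists_foreVec_eq {i : Fin T.n} (hD : cross (T.backVec i) (T.foreVec i) = 0) :
    ∃ c : ℝ, c < 0 ∧ T.foreVec i = c * T.backVec i := by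
  have hP : T.backVec i ≠ 0 := neg_ne_zero.2 (T.edgeVec_ne_zero i)
  obtain ⟨c, hc⟩ := exists_eq_mul_of_cross_eq_zero hP hD
  refine ⟨c, ?_, hc⟩
  by_contra! h0
  have hQ : T.foreVec i ≠ 0 := T.edgeVec_ne_zero _
  have hcpos : 0 < c := lt_of_le_of_ne h0 fun h => hQ (by rw [hc, ← h]; simp)
  -- otherwise the two edges overlap
  have ht : 0 < min 1 (1 / c) := lt_min one_pos (by positivity)
  have hz : T.outline (T.next i) + (min 1 (1 / c) : ℝ) * T.foreVec i = T.outline (T.next i) := by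
    apply T.edge_inter_edge_next
    · rw [edge_eq_back, segment_eq_image']
      refine ⟨min 1 (1 / c) * c, ⟨by positivity, ?_⟩, ?_⟩
      · calc min 1 (1 / c) * c ≤ 1 / c * c := by gcongr; exact min_le_right _ _
          _ = 1 := by field_simp
      · rw [hc]; simp only [Complex.real_smul]; push_cast; ring
    · rw [edge_next_eq_fore, segment_eq_image']
      exact ⟨_, ⟨ht.le, min_le_left _ _⟩, by simp⟩
  rw [add_eq_left, mul_eq_zero] at hz
  rcases hz with hz | hz
  · exact ht.ne' (by exact_mod_cast hz)
  · exact hQ hz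

/-- At a vertex, a target is locally a half plane, a convex sector or the complement of
a convex sector. -/
lemma vertex_cases (i : Fin T.n) :
    (FlatAt T.region (T.outline (T.next i)) (T.edgeVec i) ∨
      FlatAt T.region (T.outline (T.next i)) (-T.edgeVec i)) ∨
    (cross (T.backVec i) (T.foreVec i) ≠ 0 ∧
      (ConvexCornerAt T.region (T.outline (T.next i)) (T.backVec i) (T.foreVec i) ∨
        ReflexCornerAt T.region (T.outline (T.next i)) (T.backVec i) (T.foreVec i))) := by
  have hev : ∀ᶠ w in 𝓝 (T.outline (T.next i)), w ∈ frontier T.region ↔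
      (w ∈ T.edge i ∨ w ∈ T.edge (T.next i)) := by
    filter_upwards [T.eventually_mem_edge (T.outline (T.next i))] with w h
    rw [mem_frontier_iff]
    constructor
    · rintro ⟨j, hj⟩
      rcases T.eq_or_eq_next_of_mem_edge (h j hj) with rfl | rfl
      · exact Or.inl hj
      · exact Or.inr hj
    · rintro (h | h)
      · exact ⟨_, h⟩
      · exact ⟨_, h⟩
  by_cases hD : cross (T.backVec i) (T.foreVec i) = 0
  · left
    obtain ⟨c, hc, he⟩ := T.exists_foreVec_eq hD
    have hP : T.backVec i ≠ 0 := neg_ne_zero.2 (T.edgeVec_ne_zero i)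
    rw [or_comm, ← neg_neg (T.edgeVec i), neg_neg (-T.edgeVec i)]
    refine flatAt_or_flatAt_neg T.isClosed_region T.regular ?_
    filter_upwards [hev, eventually_mem_segment_or_iff hP hc (T.outline (T.next i))] with w h1 h2
    rw [h1, edge_eq_back, edge_next_eq_fore, he, h2]; rfl
  · right
    refine ⟨hD, convexCornerAt_or_reflexCornerAt T.isClosed_region T.regular hD ?_⟩
    filter_upwards [hev, T.cornerEdgesAt hD] with w h1 h2
    rw [h1, h2.1, h2.2.1]

/-- At a frontier point which is not a vertex, a target is locally a half plane. -/
lemma flatAt_of_mem_edge {i : Fin T.n} {z : ℂ} (hz : z ∈ T.edge i) (hv : ∀ k, z ≠ T.outline k) :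
    FlatAt T.region z (T.edgeVec i) ∨ FlatAt T.region z (-T.edgeVec i) := by
  refine flatAt_or_flatAt_neg T.isClosed_region T.regular ?_
  have hE := T.edgeVec_ne_zero i
  obtain ⟨s, hs, hsz⟩ : ∃ s ∈ Icc (0 : ℝ) 1, T.outline i + s * T.edgeVec i = z := by
    have := hz
    rw [edge, segment_eq_image'] at this
    simpa [edgeVec] using this
  have hs0 : 0 < s := lt_of_le_of_ne hs.1 fun h => hv i (by rw [← hsz, ← h]; simp)
  have hs1 : s < 1 := lt_of_le_of_ne hs.2 fun h => hv (T.next i) (by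
    rw [← hsz, h]; simp [edgeVec])
  have hP : ((-s : ℝ) : ℂ) * T.edgeVec i ≠ 0 :=
    mul_ne_zero (by exact_mod_cast (neg_neg_of_pos hs0).ne) hE
  have hc : (1 - s) / (-s) < 0 := div_neg_of_pos_of_neg (by linarith) (by linarith)
  filter_upwards [T.eventually_mem_edge z, eventually_mem_segment_or_iff hP hc z] with w h1 h2
  have hs' : (s : ℂ) ≠ 0 := by exact_mod_cast hs0.ne'
  rw [cross_ofReal_mul_left, mul_eq_zero, or_iff_right (neg_neg_of_pos hs0).ne] at h2
  rw [← h2, mem_frontier_iff]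
  have e1 : z + ((-s : ℝ) : ℂ) * T.edgeVec i = T.outline i := by rw [← hsz]; push_cast; ring
  have e2 : z + (((1 - s) / (-s) : ℝ) : ℂ) * (((-s : ℝ) : ℂ) * T.edgeVec i)
      = T.outline (T.next i) := by
    have : T.outline (T.next i) = T.outline i + T.edgeVec i := by simp [edgeVec]
    rw [← hsz, this]; push_cast; field_simp; ring
  rw [e1, e2]
  have hseg : T.edge i = segment ℝ z (T.outline i) ∪ segment ℝ z (T.outline (T.next i)) :=
    segment_eq_union hz
  constructor
  · rintro ⟨j, hj⟩
    have : i = j := T.edge_unique hv hz (h1 j hj)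
    rw [← this, hseg] at hj
    exact hj
  · exact fun h => ⟨i, by rw [hseg]; exact h⟩

end Target

/-! ### The inner angles -/

lemma tendsto_ray (z u : ℂ) : Tendsto (fun t : ℝ => z + t * u) (𝓝[>] 0) (𝓝 z) := by
  have : Continuous (fun t : ℝ => z + t * u) := by fun_prop
  have := this.tendsto 0
  simp only [Complex.ofReal_zero, zero_mul, add_zero] at this
  exact this.mono_left nhdsWithin_le_nhds

/-- If membership in `S` near `z` depends only on the direction, then the directions that point
from `z` into `S` are known. -/
lemma eventually_mem_ray_iff {S : Set ℂ} {z u : ℂ} {p : ℂ → Prop}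
    (h : ∀ᶠ w in 𝓝 z, w ∈ S ↔ p (w - z)) (hp : ∀ t : ℝ, 0 < t → (p (t * u) ↔ p u)) :
    (∀ᶠ t : ℝ in 𝓝[>] 0, z + t * u ∈ S) ↔ p u := by
  have h' : ∀ᶠ t : ℝ in 𝓝[>] 0, z + t * u ∈ S ↔ p u := by
    filter_upwards [(tendsto_ray z u).eventually h, self_mem_nhdsWithin] with t ht ht0
    rw [ht, add_sub_cancel_left, hp t ht0]
  rw [eventually_congr h']
  exact eventually_const

lemma coord_ofReal_mul (P Q : ℂ) (t : ℝ) (u : ℂ) : coord P Q (t * u) = t * coord P Q u := by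
  rw [← Complex.real_smul, map_smul, smul_eq_mul]

lemma measureReal_le_of_Ico_and {p q : ℝ → Prop} (h : ∀ θ, p θ → q θ) :
    volume.real {θ : ℝ | θ ∈ Ico 0 (2 * Real.pi) ∧ p θ}
      ≤ volume.real {θ : ℝ | θ ∈ Ico 0 (2 * Real.pi) ∧ q θ} := by
  refine measureReal_mono (fun θ hθ => ⟨hθ.1, h θ hθ.2⟩) ?_
  refine ((measure_mono fun θ hθ => hθ.1).trans_lt (b := volume (Ico 0 (2 * Real.pi))) ?_).ne
  rw [Real.volume_Ico]; exact ENNReal.ofReal_lt_top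

namespace Target

variable (T : Target)

lemma innerAngle_of_flatAt {k : Fin T.n} {d : ℂ} (hd : d ≠ 0)
    (h : FlatAt T.region (T.outline k) d) : T.innerAngle k = Real.pi := by
  rw [← volume_real_half_circle hd, innerAngle]
  congr 1
  ext θ
  rw [mem_ofPred_eq, mem_ofPred_eq, ← dir, eventually_mem_ray_iff (p := fun w => 0 ≤ cross d w)
    (h.mono fun w hw => hw.1)]
  intro t ht
  rw [cross_ofReal_mul_right, mul_nonneg_iff_of_pos_left ht]

lemma innerAngle_of_convexCornerAt {k : Fin T.n} {P Q : ℂ} (hD : cross P Q ≠ 0)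
    (h : ConvexCornerAt T.region (T.outline k) P Q) : T.innerAngle k ≤ Real.pi := by
  have hP : P ≠ 0 := by rintro rfl; simp at hD
  have hd : (((cross P Q)⁻¹ : ℝ) : ℂ) * P ≠ 0 :=
    mul_ne_zero (by exact_mod_cast inv_ne_zero hD) hP
  rw [← volume_real_half_circle hd, innerAngle]
  refine measureReal_le_of_Ico_and fun θ hθ => ?_
  rw [← dir, eventually_mem_ray_iff (p := fun w => 0 ≤ coord P Q w ∧ 0 ≤ coord Q P w) h] at hθ
  · have := hθ.2
    rwa [coord_swap_apply, div_eq_inv_mul, ← cross_ofReal_mul_left] at this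
  · intro t ht
    rw [coord_ofReal_mul, coord_ofReal_mul, mul_nonneg_iff_of_pos_left ht,
      mul_nonneg_iff_of_pos_left ht]

/-- The inner angle at a reflex corner, and the integral of `exists_wedge_angle` there, in terms of
the outer angle `ψ`. -/
lemma exists_angle_of_reflexCornerAt {k : Fin T.n} {P Q : ℂ} (hD : cross P Q ≠ 0)
    (h : ReflexCornerAt T.region (T.outline k) P Q) :
    ∃ ψ : ℝ, 0 < ψ ∧ ψ < Real.pi ∧ T.innerAngle k = 2 * Real.pi - ψ ∧
      ∫ θ in (0 : ℝ)..(2 * Real.pi), max 0 (cross P (dir θ) * cross Q (dir θ)) / |cross P Q|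
        = (Real.pi - ψ) / Real.tan ψ + 1 := by
  obtain ⟨ψ, h0, hπ, hvol, hint⟩ := exists_wedge_angle hD
  refine ⟨ψ, h0, hπ, ?_, hint⟩
  rw [innerAngle, ← hvol]
  have hset : {θ : ℝ | θ ∈ Ico 0 (2 * Real.pi) ∧
      ∀ᶠ t : ℝ in 𝓝[>] 0, T.outline k + t * Complex.exp (θ * Complex.I) ∈ T.region}
      = Ico 0 (2 * Real.pi) \ {θ : ℝ | θ ∈ Ico 0 (2 * Real.pi) ∧
        (0 < cross (dir θ) Q / cross P Q ∧ 0 < cross P (dir θ) / cross P Q)} := by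
    ext θ
    rw [mem_ofPred_eq, Set.mem_sdiff, mem_ofPred_eq, ← dir,
      eventually_mem_ray_iff (p := fun w => ¬ (0 < coord P Q w ∧ 0 < coord Q P w)) h,
      coord_swap_apply P Q, coord_apply P Q]
    · tauto
    · intro t ht
      rw [coord_ofReal_mul, coord_ofReal_mul, mul_pos_iff_of_pos_left ht,
        mul_pos_iff_of_pos_left ht]
  rw [hset, measureReal_sdiff (h₁ := by rw [Real.volume_Ico]; exact ENNReal.ofReal_ne_top)]
  · rw [measureReal_def, Real.volume_Ico, sub_zero, ENNReal.toReal_ofReal (by positivity)]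
  · intro θ hθ
    exact hθ.1
  · refine measurableSet_Ico.inter (MeasurableSet.inter ?_ ?_)
    · exact measurableSet_lt measurable_const
        (((continuous_cross_left Q).comp continuous_dir).div_const _).measurable
    · exact measurableSet_lt measurable_const
        (((continuous_cross_right P).comp continuous_dir).div_const _).measurable

/-- The `next i`-th vertex is a reflex corner. (Corners are indexed by the edge that ends there.) -/
def IsReflex (i : Fin T.n) : Prop :=
  cross (T.backVec i) (T.foreVec i) ≠ 0 ∧
    ReflexCornerAt T.region (T.outline (T.next i)) (T.backVec i) (T.foreVec i)

/-- The integral over all directions of the area of the triangles of `volume_sweep_inter` at the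
`next i`-th vertex, up to the factor `r ^ 2 / 2`. -/
def cornerIntegral (i : Fin T.n) : ℝ :=
  ∫ θ in (0 : ℝ)..(2 * Real.pi), max 0 (cross (T.backVec i) (dir θ) * cross (T.foreVec i) (dir θ)) /
    |cross (T.backVec i) (T.foreVec i)|

lemma pi_lt_innerAngle_iff (i : Fin T.n) : Real.pi < T.innerAngle (T.next i) ↔ T.IsReflex i := by
  constructor
  · intro h
    have hd := T.edgeVec_ne_zero i
    rcases T.vertex_cases i with (h' | h') | ⟨hD, h' | h'⟩
    · exact absurd (T.innerAngle_of_flatAt hd h') h.ne'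
    · exact absurd (T.innerAngle_of_flatAt (neg_ne_zero.2 hd) h') h.ne'
    · exact absurd (T.innerAngle_of_convexCornerAt hD h') h.not_ge
    · exact ⟨hD, h'⟩
  · rintro ⟨hD, h⟩
    obtain ⟨ψ, _, hπ, hψ, _⟩ := T.exists_angle_of_reflexCornerAt hD h
    rw [hψ]; linarith

lemma g₁_innerAngle {i : Fin T.n} (h : T.IsReflex i) :
    g₁ (T.innerAngle (T.next i)) = -2 * T.cornerIntegral i := by
  obtain ⟨ψ, _, _, hψ, hint⟩ := T.exists_angle_of_reflexCornerAt h.1 h.2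
  have htan : Real.tan (2 * Real.pi - ψ) = -Real.tan ψ := by
    rw [show 2 * Real.pi - ψ = -ψ + Real.pi + Real.pi by ring, Real.tan_add_pi, Real.tan_add_pi,
      Real.tan_neg]
  rw [cornerIntegral, hint, hψ, g₁, htan, div_neg]
  ring

end Target

/-- With `x = φ - π` this says that `x / tan x < 1` on `(0, π)`. -/
lemma g₁_neg {φ : ℝ} (h1 : Real.pi < φ) (h2 : φ < 2 * Real.pi) : g₁ φ < 0 := by
  have ht : Real.tan φ = Real.tan (φ - Real.pi) := (Real.tan_sub_pi φ).symm
  rw [g₁, ht]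
  set x := φ - Real.pi
  have hx0 : 0 < x := by simp only [x]; linarith
  have hxπ : x < Real.pi := by simp only [x]; linarith
  have : x / Real.tan x < 1 := by
    rcases lt_or_ge x (Real.pi / 2) with h | h
    · have := Real.lt_tan hx0 h
      exact (div_lt_one (hx0.trans this)).2 this
    · have hle : Real.tan x ≤ 0 := by
        rw [← Real.tan_sub_pi]
        exact Real.tan_nonpos_of_nonpos_of_neg_pi_div_two_le (by linarith) (by linarith)
      exact (div_nonpos_of_nonneg_of_nonpos hx0.le hle).trans_lt one_pos
  rw [mul_div_assoc]; linarith

namespace Target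

variable (T : Target)

open Classical in
lemma concavity_eq : T.concavity = ∑ i, if T.IsReflex i then -2 * T.cornerIntegral i else 0 := by
  rw [concavity, ← Equiv.sum_comp (finRotate T.n)]
  refine Finset.sum_congr rfl fun i _ => ?_
  by_cases h : T.IsReflex i
  · rw [if_pos ((T.pi_lt_innerAngle_iff i).2 h), if_pos h, T.g₁_innerAngle h]
  · rw [if_neg (mt (T.pi_lt_innerAngle_iff i).1 h), if_neg h]

lemma concavity_eq_zero (h : ∀ i, ¬ T.IsReflex i) : T.concavity = 0 := by
  rw [concavity_eq]
  exact Finset.sum_eq_zero fun i _ => if_neg (h i)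

lemma concavity_neg {i : Fin T.n} (h : T.IsReflex i) : T.concavity < 0 := by
  have key : ∀ j, T.IsReflex j → -2 * T.cornerIntegral j < 0 := by
    intro j hj
    rw [← T.g₁_innerAngle hj]
    obtain ⟨ψ, h0, hπ, hψ, _⟩ := T.exists_angle_of_reflexCornerAt hj.1 hj.2
    exact g₁_neg (by linarith) (by linarith)
  rw [concavity_eq]
  refine Finset.sum_neg' (fun j _ => ?_) ⟨i, Finset.mem_univ _, ?_⟩
  · split_ifs with hj
    · exact (key j hj).le
    · exact le_rfl
  · rw [if_pos h]; exact key i h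

/-! ### Convexity -/

lemma not_isReflex_of_convex (hT : Convex ℝ T.region) (i : Fin T.n) : ¬ T.IsReflex i := by
  rintro ⟨hD, h⟩
  set z := T.outline (T.next i)
  set P := T.backVec i
  set Q := T.foreVec i
  have hD' := cross_swap_ne_zero hD
  -- test points on either side of the exterior sector, with midpoint inside the sector
  obtain ⟨t, ⟨⟨h1, h2⟩, h3⟩, ht⟩ := (((((tendsto_ray z (2 * P - Q)).eventually h).and
    ((tendsto_ray z (2 * Q - P)).eventually h)).and
    ((tendsto_ray z ((1 / 2) * P + (1 / 2) * Q)).eventually h)).and self_mem_nhdsWithin).exists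
  have ht : 0 < t := ht
  have e1 : t * (2 * P - Q) = ((2 * t : ℝ) : ℂ) * P + ((-t : ℝ) : ℂ) * Q := by push_cast; ring
  have e2 : t * (2 * Q - P) = ((2 * t : ℝ) : ℂ) * Q + ((-t : ℝ) : ℂ) * P := by push_cast; ring
  have e3 : t * ((1 / 2) * P + (1 / 2) * Q) = ((t / 2 : ℝ) : ℂ) * P + ((t / 2 : ℝ) : ℂ) * Q := by
    push_cast; ring
  have m1 : z + t * (2 * P - Q) ∈ T.region := by
    rw [h1, add_sub_cancel_left, e1, add_comm, coord_combination hD']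
    exact fun h => by linarith [h.2]
  have m2 : z + t * (2 * Q - P) ∈ T.region := by
    rw [h2, add_sub_cancel_left, e2, add_comm, coord_combination hD]
    exact fun h => by linarith [h.1]
  have m3 := hT m1 m2 (a := 1 / 2) (b := 1 / 2) (by norm_num) (by norm_num) (by norm_num)
  rw [show (1 / 2 : ℝ) • (z + t * (2 * P - Q)) + (1 / 2 : ℝ) • (z + t * (2 * Q - P))
    = z + t * ((1 / 2) * P + (1 / 2) * Q) by simp only [Complex.real_smul]; push_cast; ring, h3,
    add_sub_cancel_left, e3, coord_combination hD, add_comm, coord_combination hD'] at m3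
  exact m3 ⟨by positivity, by positivity⟩

lemma locally_convex (h : ∀ i, ¬ T.IsReflex i) {z : ℂ} (hz : z ∈ T.region) :
    ∃ δ > 0, Convex ℝ (T.region ∩ Metric.ball z δ) := by
  have aux : ∀ {C : Set ℂ}, Convex ℝ C → (∀ᶠ w in 𝓝 z, w ∈ T.region ↔ w ∈ C) →
      ∃ δ > 0, Convex ℝ (T.region ∩ Metric.ball z δ) := by
    intro C hC hev
    obtain ⟨δ, hδ, hb⟩ := Metric.eventually_nhds_iff_ball.1 hev
    refine ⟨δ, hδ, ?_⟩
    have : T.region ∩ Metric.ball z δ = C ∩ Metric.ball z δ := by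
      ext w
      exact and_congr_left fun hw => hb w hw
    rw [this]
    exact hC.inter (convex_ball _ _)
  have flat : ∀ {d : ℂ}, FlatAt T.region z d → ∃ δ > 0, Convex ℝ (T.region ∩ Metric.ball z δ) :=
    fun {d} hd => aux (convex_setOf_nonneg (crossLeft d) z) (hd.mono fun w hw => hw.1)
  by_cases hf : z ∈ frontier T.region
  · by_cases hv : ∀ k, z ≠ T.outline k
    · obtain ⟨i, hi⟩ := T.mem_frontier_iff.1 hf
      exact (T.flatAt_of_mem_edge hi hv).elim flat flat
    · push Not at hv
      obtain ⟨k, rfl⟩ := hv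
      obtain ⟨i, rfl⟩ := (finRotate T.n).surjective k
      rcases T.vertex_cases i with h' | ⟨hD, h' | h'⟩
      · exact h'.elim flat flat
      · exact aux ((convex_setOf_nonneg _ _).inter (convex_setOf_nonneg _ _)) h'
      · exact absurd ⟨hD, h'⟩ (h i)
  · refine aux convex_univ ?_
    have hint : z ∈ interior T.region := by
      by_contra hc
      exact hf ⟨subset_closure hz, hc⟩
    filter_upwards [mem_interior_iff_mem_nhds.1 hint] with w hw
    simp [hw]

end Target

/-! ### Connected locally convex sets are convex -/

/-- A compact locally convex set contains the segments between any two of its points that are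
sufficiently close. -/
lemma exists_pos_forall_segment_subset {S : Set ℂ} (hS : IsCompact S)
    (hloc : ∀ z ∈ S, ∃ δ > 0, Convex ℝ (S ∩ Metric.ball z δ)) :
    ∃ δ > 0, ∀ x ∈ S, ∀ y ∈ S, dist x y < δ → segment ℝ x y ⊆ S := by
  choose! r hr hconv using hloc
  obtain ⟨δ, hδ, h⟩ := lebesgue_number_lemma_of_metric (c := fun z : S => Metric.ball (z : ℂ) (r z))
    hS (fun _ => Metric.isOpen_ball)
    (fun z hz => mem_iUnion.2 ⟨⟨z, hz⟩, Metric.mem_ball_self (hr z hz)⟩)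
  refine ⟨δ, hδ, fun x hx y hy hxy => ?_⟩
  obtain ⟨z, hz⟩ := h x hx
  have := (hconv z z.2).segment_subset ⟨hx, hz (Metric.mem_ball_self hδ)⟩
    ⟨hy, hz (by rwa [Metric.mem_ball, dist_comm])⟩
  exact this.trans inter_subset_left

/-- In a compact locally convex set, visibility is transitive: the segment that cuts the corner
`a b c` at `b` can be pushed away from `b` all the way to the segment from `a` to `c`. -/
lemma segment_subset_of_segment_subset {S : Set ℂ} (hS : IsCompact S)
    (hloc : ∀ z ∈ S, ∃ δ > 0, Convex ℝ (S ∩ Metric.ball z δ)) {a b c : ℂ}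
    (ha : segment ℝ b a ⊆ S) (hc : segment ℝ b c ⊆ S) : segment ℝ a c ⊆ S := by
  obtain ⟨δ, hδ, H⟩ := exists_pos_forall_segment_subset hS hloc
  have hb : b ∈ S := ha (left_mem_segment _ _ _)
  set w : ℝ → ℂ := fun l => (a - b) + l * (c - a) with hw
  have hcont : ∀ l, Continuous fun s : ℝ => b + s * w l := fun l => by fun_prop
  -- `A` is the set of positions of the moving segment inside `S`
  set A : Set ℝ := {s | ∀ l ∈ Icc (0 : ℝ) 1, b + s * w l ∈ S} with hA
  have hAclosed : IsClosed A := by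
    have : A = ⋂ l ∈ Icc (0 : ℝ) 1, (fun s : ℝ => b + s * w l) ⁻¹' S := by
      ext s; simp [hA]
    rw [this]
    exact isClosed_biInter fun l _ => hS.isClosed.preimage (hcont l)
  have hA0 : (0 : ℝ) ∈ A := fun l _ => by simpa using hb
  -- the ends of the moving segment stay in `S`
  have hend0 : ∀ s ∈ Icc (0 : ℝ) 1, b + s * w 0 ∈ S := by
    intro s hs
    apply ha
    rw [segment_eq_image']
    exact ⟨s, hs, by simp [hw]⟩
  have hend1 : ∀ s ∈ Icc (0 : ℝ) 1, b + s * w 1 ∈ S := by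
    intro s hs
    apply hc
    rw [segment_eq_image']
    exact ⟨s, hs, by simp [hw]⟩
  -- a position between two points of `S` that are close to one another
  have hbetween : ∀ s l₁ l₂ l : ℝ, l₁ ≤ l → l ≤ l₂ → b + s * w l₁ ∈ S → b + s * w l₂ ∈ S →
      dist (b + s * w l₁) (b + s * w l₂) < δ → b + s * w l ∈ S := by
    intro s l₁ l₂ l h1 h2 m1 m2 hd
    apply H _ m1 _ m2 hd
    have : l ∈ segment ℝ l₁ l₂ := by rw [segment_eq_Icc (h1.trans h2)]; exact ⟨h1, h2⟩
    obtain ⟨p, q, hp, hq, hpq, rfl⟩ := this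
    refine ⟨p, q, hp, hq, hpq, ?_⟩
    have hpq' : (p : ℂ) + q = 1 := by exact_mod_cast hpq
    simp only [hw, Complex.real_smul, smul_eq_mul]
    push_cast
    linear_combination (b + s * (a - b)) * hpq'
  have hdist : ∀ s l₁ l₂ : ℝ, dist (b + s * w l₁) (b + s * w l₂) = |s| * (|l₁ - l₂| * ‖c - a‖) := by
    intro s l₁ l₂
    rw [dist_eq_norm, show b + s * w l₁ - (b + s * w l₂) = s * ((l₁ - l₂ : ℝ) * (c - a)) by
      simp only [hw]; push_cast; ring, norm_mul, norm_mul, Complex.norm_real, Complex.norm_real,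
      Real.norm_eq_abs, Real.norm_eq_abs]
  have hstep : ∀ s ∈ A ∩ Ico 0 1, A ∈ 𝓝[>] s := by
    rintro s ⟨hsA, hs0, hs1⟩
    have hev01 : ∀ᶠ s' in 𝓝[>] s, s' ∈ Icc (0 : ℝ) 1 := by
      filter_upwards [Ioo_mem_nhdsGT hs1] with s' hs'
      exact ⟨hs0.trans hs'.1.le, hs'.2.le⟩
    rcases hs0.eq_or_lt with rfl | hspos
    · -- the moving segment starts from the point `b`
      have hsmall : ∀ᶠ s' : ℝ in 𝓝[>] 0, dist (b + s' * w 0) (b + s' * w 1) < δ := by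
        have hcd : Continuous fun s' : ℝ => dist (b + s' * w 0) (b + s' * w 1) :=
          (hcont 0).dist (hcont 1)
        exact ((hcd.tendsto 0).mono_left nhdsWithin_le_nhds).eventually_lt_const (by simpa using hδ)
      filter_upwards [hsmall, hev01] with s' h1 h2 l hl
      exact hbetween s' 0 1 l hl.1 hl.2 (hend0 s' h2) (hend1 s' h2) h1
    · obtain ⟨N, hN⟩ := exists_nat_gt (‖c - a‖ / (δ / 4))
      have hNpos : (0 : ℝ) < N := lt_of_le_of_lt (by positivity) hN
      have hmesh : 1 / N * ‖c - a‖ < δ / 4 := by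
        rw [div_lt_iff₀ (by positivity)] at hN
        rw [one_div, inv_mul_lt_iff₀ hNpos]
        linarith
      have hmem : ∀ k : ℕ, k ≤ N → (k / N : ℝ) ∈ Icc (0 : ℝ) 1 := fun k hk =>
        ⟨by positivity, div_le_one_of_le₀ (by exact_mod_cast hk) hNpos.le⟩
      have hnext : ∀ k : ℕ, |(k / N : ℝ) - ((k + 1 : ℕ) / N : ℝ)| = 1 / N := by
        intro k
        rw [← sub_div, Nat.cast_succ, sub_add_cancel_left, abs_div, abs_neg, abs_one,
          abs_of_pos hNpos]
      have hadj : ∀ (s : ℝ) (k : ℕ), s ∈ Icc (0 : ℝ) 1 →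
          dist (b + s * w (k / N)) (b + s * w ((k + 1 : ℕ) / N)) < δ / 4 := by
        intro s k hs
        rw [hdist, hnext, abs_of_nonneg hs.1]
        exact (mul_le_of_le_one_left (by positivity) hs.2).trans_lt hmesh
      -- the points that divide the moving segment advance one after the other
      have hgrid : ∀ k : ℕ, k ≤ N → ∀ᶠ s' : ℝ in 𝓝[>] s, b + s' * w (k / N) ∈ S := by
        intro k
        induction k with
        | zero =>
          intro _
          filter_upwards [hev01] with s' hs'
          simpa using hend0 s' hs'
        | succ k ih =>
          intro hk
          rcases hk.eq_or_lt with hk' | hk'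
          · filter_upwards [hev01] with s' hs'
            rw [hk', div_self hNpos.ne']
            exact hend1 s' hs'
          · have hclose : ∀ᶠ s' : ℝ in 𝓝[>] s,
                dist (b + s * w ((k + 1 : ℕ) / N)) (b + s' * w (k / N)) < δ / 4 := by
              have hcd : Continuous fun s' : ℝ =>
                  dist (b + s * w ((k + 1 : ℕ) / N)) (b + s' * w (k / N)) :=
                continuous_const.dist (hcont _)
              refine ((hcd.tendsto s).mono_left nhdsWithin_le_nhds).eventually_lt_const ?_
              rw [dist_comm]
              exact hadj s k ⟨hs0, hs1.le⟩
            obtain ⟨s₁, ⟨m1, d1⟩, hs₁⟩ :=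
              (((ih (by omega)).and hclose).and self_mem_nhdsWithin).exists
            have hs₁ : s < s₁ := hs₁
            have hz := hsA _ (hmem (k + 1) hk)
            have m2 := hsA _ (hmem (k + 2) hk')
            have d2 := hadj s (k + 1) ⟨hs0, hs1.le⟩
            have hsub := H _ m1 _ m2 (by
              calc _ ≤ _ := dist_triangle_left _ _ (b + s * w ((k + 1 : ℕ) / N))
                _ < δ := by linarith)
            -- the point where the segment just found crosses the ray towards the middle point
            set s₂ : ℝ := 2 * s * s₁ / (s + s₁) with hs₂
            have hsum : 0 < s + s₁ := by linarith
            have hq : b + s₂ * w ((k + 1 : ℕ) / N) ∈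
                segment ℝ (b + s₁ * w (k / N)) (b + s * w ((k + 2 : ℕ) / N)) := by
              refine ⟨s / (s + s₁), s₁ / (s + s₁), by positivity,
                div_nonneg (by linarith) hsum.le, by rw [← add_div, div_self hsum.ne'], ?_⟩
              have h1 : (s : ℂ) + s₁ ≠ 0 := by exact_mod_cast hsum.ne'
              have h2 : (N : ℂ) ≠ 0 := by exact_mod_cast hNpos.ne'
              simp only [hw, hs₂, Complex.real_smul]
              push_cast
              field_simp
              ring
            have hball := (convex_ball (b + s * w ((k + 1 : ℕ) / N)) δ).segment_subset
              (x := b + s₁ * w (k / N)) (y := b + s * w ((k + 2 : ℕ) / N))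
              (by rw [Metric.mem_ball, dist_comm]; linarith)
              (by rw [Metric.mem_ball, dist_comm]; linarith) hq
            have hseg := H _ hz _ (hsub hq) (by rw [dist_comm]; exact hball)
            have hlt : s < s₂ := by
              rw [hs₂, lt_div_iff₀ hsum]
              nlinarith
            filter_upwards [Ioo_mem_nhdsGT hlt] with s' hs'
            apply hseg
            have : s' ∈ segment ℝ s s₂ := by
              rw [segment_eq_Icc hlt.le]; exact ⟨hs'.1.le, hs'.2.le⟩
            obtain ⟨p, q, hp, hq, hpq, rfl⟩ := this
            refine ⟨p, q, hp, hq, hpq, ?_⟩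
            have hpq' : (p : ℂ) + q = 1 := by exact_mod_cast hpq
            simp only [Complex.real_smul, smul_eq_mul]
            push_cast
            linear_combination b * hpq'
      have hall : ∀ᶠ s' : ℝ in 𝓝[>] s, ∀ k ∈ Finset.range (N + 1), b + s' * w (k / N) ∈ S :=
        (Finset.eventually_all _).2 fun k hk => hgrid k (by
          have := Finset.mem_range.1 hk; omega)
      filter_upwards [hall, hev01] with s' h1 h2 l hl
      have hl' : (⌊l * N⌋₊ : ℝ) ≤ l * N := Nat.floor_le (mul_nonneg hl.1 hNpos.le)
      have hl'' : l * N < ⌊l * N⌋₊ + 1 := Nat.lt_floor_add_one _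
      have hle : ⌊l * N⌋₊ ≤ N := by
        have : (⌊l * N⌋₊ : ℝ) ≤ N := hl'.trans (mul_le_of_le_one_left hNpos.le hl.2)
        exact_mod_cast this
      rcases hle.eq_or_lt with he | hlt
      · have : l = 1 := by
          rw [he] at hl'
          exact le_antisymm hl.2 (by nlinarith)
        rw [this]; exact hend1 s' h2
      · refine hbetween s' (⌊l * N⌋₊ / N) ((⌊l * N⌋₊ + 1 : ℕ) / N) l ?_ ?_ (h1 _ ?_) (h1 _ ?_) ?_
        · rwa [div_le_iff₀ hNpos]
        · rw [le_div_iff₀ hNpos]; push_cast; exact hl''.le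
        · exact Finset.mem_range.2 (by omega)
        · exact Finset.mem_range.2 (by omega)
        · exact (hadj s' _ h2).trans (by linarith)
  have hA1 : (1 : ℝ) ∈ A :=
    (hAclosed.inter isClosed_Icc).Icc_subset_of_forall_mem_nhdsWithin hA0 hstep
      (right_mem_Icc.2 zero_le_one)
  rw [segment_eq_image']
  rintro _ ⟨l, hl, rfl⟩
  have := hA1 l hl
  simp only [hw] at this
  simp only [Complex.real_smul]
  convert this using 1
  push_cast; ring

namespace Target

variable (T : Target)

/-- Every point of the target sees a frontier point. -/
lemma exists_segment_to_frontier {x : ℂ} (hx : x ∈ T.region) :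
    ∃ z ∈ frontier T.region, segment ℝ x z ⊆ T.region := by
  have hcpt : IsCompact (frontier T.region) :=
    T.isCompact.of_isClosed_subset isClosed_frontier T.isClosed_region.frontier_subset
  have h0 : 0 < T.n := lt_of_lt_of_le (by norm_num) T.three_le
  have hne : (frontier T.region).Nonempty :=
    ⟨_, T.mem_frontier_iff.2 ⟨⟨0, h0⟩, T.left_mem_edge _⟩⟩
  obtain ⟨z, hz, hd⟩ := hcpt.exists_infDist_eq_dist hne x
  refine ⟨z, hz, ?_⟩
  rcases eq_or_ne x z with rfl | hxz
  · rw [segment_same]; exact singleton_subset_iff.2 hx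
  have hpos : 0 < dist x z := dist_pos.2 hxz
  rcases subset_or_disjoint_of_frontier (S := T.region)
    (convex_ball x (dist x z)).isPreconnected (fun w hw hwf => by
      have := Metric.infDist_le_dist_of_mem (x := x) hwf
      rw [hd, dist_comm x w] at this
      exact absurd hw (not_lt.2 this)) with h | h
  · have hcl : Metric.closedBall x (dist x z) ⊆ T.region := by
      rw [← closure_ball x hpos.ne']
      exact closure_minimal h T.isClosed_region
    refine ((convex_closedBall x (dist x z)).segment_subset ?_ ?_).trans hcl
    · exact Metric.mem_closedBall_self hpos.le
    · rw [Metric.mem_closedBall, dist_comm]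
  · exact absurd hx (h x (Metric.mem_ball_self hpos))

/-- A target without reflex corners is convex. -/
lemma convex_of_forall_not_isReflex (h : ∀ i, ¬ T.IsReflex i) : Convex ℝ T.region := by
  have trans : ∀ {a b c : ℂ}, segment ℝ a b ⊆ T.region → segment ℝ b c ⊆ T.region →
      segment ℝ a c ⊆ T.region := fun hab hbc =>
    segment_subset_of_segment_subset T.isCompact (fun z hz => T.locally_convex h hz)
      (by rwa [segment_symm]) hbc
  have hedge : ∀ i, T.edge i ⊆ T.region := fun i w hw =>
    T.isClosed_region.frontier_subset (T.mem_frontier_iff.2 ⟨i, hw⟩)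
  have h0 : 0 < T.n := lt_of_lt_of_le (by norm_num) T.three_le
  have hvert : ∀ k (hk : k < T.n),
      segment ℝ (T.outline ⟨0, h0⟩) (T.outline ⟨k, hk⟩) ⊆ T.region := by
    intro k
    induction k with
    | zero =>
      intro _
      rw [segment_same]
      exact singleton_subset_iff.2 (hedge _ (T.left_mem_edge _))
    | succ k ih =>
      intro hk
      refine trans (ih (by omega)) ?_
      have hn : T.next ⟨k, by omega⟩ = ⟨k + 1, hk⟩ := by
        have := (⟨k, by omega⟩ : Fin T.n).neZero
        rw [next, finRotate_apply, Fin.ext_iff, Fin.val_add, Fin.val_one',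
          Nat.mod_eq_of_lt (by omega : 1 < T.n), Nat.mod_eq_of_lt hk]
      rw [← hn]
      exact hedge _
  have hall : ∀ x ∈ T.region, segment ℝ x (T.outline ⟨0, h0⟩) ⊆ T.region := by
    intro x hx
    obtain ⟨z, hz, hxz⟩ := T.exists_segment_to_frontier hx
    obtain ⟨i, hi⟩ := T.mem_frontier_iff.1 hz
    have hzi : segment ℝ z (T.outline i) ⊆ T.region :=
      ((convex_segment _ _).segment_subset hi (T.left_mem_edge i)).trans (hedge i)
    refine trans (trans hxz hzi) ?_
    rw [segment_symm]
    exact hvert i i.2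
  rw [convex_iff_segment_subset]
  intro x hx y hy
  refine trans (hall x hx) ?_
  rw [segment_symm]
  exact hall y hy

end Target

/-! ### Short needles -/

/-- A moving point that crosses the positive half of the axis `b = 0` either enters or leaves the
open quadrant for good, or it crosses the whole quadrant and also meets the positive half of
the axis `a = 0`. -/
lemma quadrant_crossing {a b u v r t : ℝ} (hv : v ≠ 0) (ht : t ∈ Icc 0 r) (hb : b + t * v = 0)
    (ha : 0 ≤ a + t * u) (hapex : ∀ t ∈ Icc 0 r, a + t * u = 0 → b + t * v = 0 → False)
    (h0 : b = 0 → 0 ≤ a → False) (h1 : b + r * v = 0 → 0 ≤ a + r * u → False) :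
    ((∃ t ∈ Icc 0 r, a + t * u = 0 ∧ 0 ≤ b + t * v) ∧ ¬ (0 < a ∧ 0 < b) ∧
        ¬ (0 < a + r * u ∧ 0 < b + r * v)) ∨
      (¬ (∃ t ∈ Icc 0 r, a + t * u = 0 ∧ 0 ≤ b + t * v) ∧
        ((0 < a ∧ 0 < b ∧ ¬ (0 < a + r * u ∧ 0 < b + r * v)) ∨
          (¬ (0 < a ∧ 0 < b) ∧ 0 < a + r * u ∧ 0 < b + r * v))) := by
  have hapos : 0 < a + t * u := lt_of_le_of_ne ha fun h => hapex t ht h.symm hb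
  have ht0 : 0 < t := lt_of_le_of_ne ht.1 fun h => h0 (by rw [← h] at hb; linarith)
    (by rw [← h] at ha; linarith)
  have htr : t < r := lt_of_le_of_ne ht.2 fun h => h1 (by rw [← h]; exact hb)
    (by rw [← h]; exact ha)
  rcases lt_or_gt_of_ne hv with hv | hv
  · -- `b` decreases, so that the point can only start in the quadrant
    have hb0 : 0 < b := by nlinarith
    have hb1 : b + r * v < 0 := by nlinarith
    by_cases ha0 : 0 < a
    · right
      refine ⟨?_, Or.inl ⟨ha0, hb0, fun h => by linarith [h.2]⟩⟩
      rintro ⟨s, hs, hsa, hsb⟩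
      have hst : s ≤ t := by
        by_contra! h
        nlinarith
      rcases le_or_gt 0 u with hu | hu
      · nlinarith [mul_nonneg hs.1 hu]
      · nlinarith
    · left
      refine ⟨?_, fun h => ha0 h.1, fun h => by linarith [h.2]⟩
      push Not at ha0
      have hu : 0 < u := by
        by_contra! h
        nlinarith
      have hs : -a / u ≤ t := by rw [div_le_iff₀ hu]; linarith
      refine ⟨-a / u, ⟨div_nonneg (by linarith) hu.le, hs.trans ht.2⟩, by rw [div_mul_cancel₀ _ hu.ne']; ring, ?_⟩
      nlinarith
  · have hb0 : b < 0 := by nlinarith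
    have hb1 : 0 < b + r * v := by nlinarith
    by_cases ha1 : 0 < a + r * u
    · right
      refine ⟨?_, Or.inr ⟨fun h => by linarith [h.2], ha1, hb1⟩⟩
      rintro ⟨s, hs, hsa, hsb⟩
      have hst : t ≤ s := by
        by_contra! h
        nlinarith
      rcases le_or_gt 0 u with hu | hu
      · nlinarith
      · nlinarith [hs.2]
    · left
      refine ⟨?_, fun h => by linarith [h.2], fun h => ha1 h.1⟩
      push Not at ha1
      have hu : u < 0 := by
        by_contra! h
        nlinarith
      have hs : t ≤ -a / u := by rw [le_div_iff_of_neg hu]; linarith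
      have hsr : -a / u ≤ r := by rw [div_le_iff_of_neg hu]; linarith
      refine ⟨-a / u, ⟨ht.1.trans hs, hsr⟩, by rw [div_mul_cancel₀ _ hu.ne]; ring, ?_⟩
      nlinarith

namespace Target

variable (T : Target)

/-- On `U` the target is a half plane bounded by the line through `z` in direction `d`. -/
def FlatOn (z d : ℂ) (U : Set ℂ) : Prop :=
  ∀ w ∈ U, (w ∈ T.region ↔ 0 ≤ cross d (w - z)) ∧ (w ∈ frontier T.region ↔ cross d (w - z) = 0)

/-- On `U` the target is bounded by the two edges at the vertex `next i`, which are not parallel: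
it is the sector between them if the vertex is not reflex, and the complement of this sector if
it is. -/
def CornerOn (i : Fin T.n) (U : Set ℂ) : Prop :=
  ∀ w ∈ U,
    ((w ∈ T.edge i ↔ 0 ≤ coord (T.backVec i) (T.foreVec i) (w - T.outline (T.next i)) ∧
      coord (T.foreVec i) (T.backVec i) (w - T.outline (T.next i)) = 0) ∧
    (w ∈ T.edge (T.next i) ↔ coord (T.backVec i) (T.foreVec i) (w - T.outline (T.next i)) = 0 ∧
      0 ≤ coord (T.foreVec i) (T.backVec i) (w - T.outline (T.next i))) ∧
    ∀ j, w ∈ T.edge j → j = i ∨ j = T.next i) ∧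
    (T.IsReflex i → (w ∈ T.region ↔
      ¬ (0 < coord (T.backVec i) (T.foreVec i) (w - T.outline (T.next i)) ∧
        0 < coord (T.foreVec i) (T.backVec i) (w - T.outline (T.next i))))) ∧
    (¬ T.IsReflex i → (w ∈ T.region ↔
      0 ≤ coord (T.backVec i) (T.foreVec i) (w - T.outline (T.next i)) ∧
        0 ≤ coord (T.foreVec i) (T.backVec i) (w - T.outline (T.next i))))

/-- On `U` the target is a half plane, with boundary parallel to an edge, or it is given by
a corner. -/
def SimpleOn (U : Set ℂ) : Prop :=
  (∃ z i, T.FlatOn z (T.edgeVec i) U ∨ T.FlatOn z (-T.edgeVec i) U) ∨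
    ∃ i, cross (T.backVec i) (T.foreVec i) ≠ 0 ∧ T.CornerOn i U

variable {T}

lemma SimpleOn.mono {U V : Set ℂ} (h : T.SimpleOn U) (hVU : V ⊆ U) : T.SimpleOn V := by
  rcases h with ⟨z, i, h | h⟩ | ⟨i, hD, h⟩
  · exact Or.inl ⟨z, i, Or.inl fun w hw => h w (hVU hw)⟩
  · exact Or.inl ⟨z, i, Or.inr fun w hw => h w (hVU hw)⟩
  · exact Or.inr ⟨i, hD, fun w hw => h w (hVU hw)⟩

variable (T)

lemma exists_simpleOn_ball {z : ℂ} (hz : z ∈ frontier T.region) :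
    ∃ δ > 0, T.SimpleOn (Metric.ball z δ) := by
  have flat : ∀ {i}, (FlatAt T.region z (T.edgeVec i) ∨ FlatAt T.region z (-T.edgeVec i)) →
      ∃ δ > 0, T.SimpleOn (Metric.ball z δ) := by
    rintro i (h | h) <;> obtain ⟨δ, hδ, hb⟩ := Metric.eventually_nhds_iff_ball.1 h
    · exact ⟨δ, hδ, Or.inl ⟨z, i, Or.inl hb⟩⟩
    · exact ⟨δ, hδ, Or.inl ⟨z, i, Or.inr hb⟩⟩
  by_cases hv : ∀ k, z ≠ T.outline k
  · obtain ⟨i, hi⟩ := T.mem_frontier_iff.1 hz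
    exact flat (T.flatAt_of_mem_edge hi hv)
  push Not at hv
  obtain ⟨k, rfl⟩ := hv
  obtain ⟨i, rfl⟩ := (finRotate T.n).surjective k
  rcases T.vertex_cases i with h | ⟨hD, h | h⟩
  · exact flat h
  · have hr : ¬ T.IsReflex i := fun hr =>
      (T.innerAngle_of_convexCornerAt hD h).not_gt ((T.pi_lt_innerAngle_iff i).2 hr)
    obtain ⟨δ, hδ, hb⟩ := Metric.eventually_nhds_iff_ball.1 ((T.cornerEdgesAt hD).and h)
    exact ⟨δ, hδ, Or.inr ⟨i, hD, fun w hw =>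
      ⟨(hb w hw).1, fun h' => absurd h' hr, fun _ => (hb w hw).2⟩⟩⟩
  · have hr : T.IsReflex i := ⟨hD, h⟩
    obtain ⟨δ, hδ, hb⟩ := Metric.eventually_nhds_iff_ball.1 ((T.cornerEdgesAt hD).and h)
    exact ⟨δ, hδ, Or.inr ⟨i, hD, fun w hw =>
      ⟨(hb w hw).1, fun _ => (hb w hw).2, fun h' => absurd hr h'⟩⟩⟩

lemma isCompact_frontier : IsCompact (frontier T.region) :=
  T.isCompact.of_isClosed_subset isClosed_frontier T.isClosed_region.frontier_subset

/-- There is a scale below which the target has a simple shape about every frontier point. -/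
lemma exists_scale : ∃ δ > 0, ∀ y ∈ frontier T.region, T.SimpleOn (Metric.ball y δ) := by
  have h := fun z (hz : z ∈ frontier T.region) => T.exists_simpleOn_ball hz
  choose! r hr hs using h
  obtain ⟨δ, hδ, h⟩ := lebesgue_number_lemma_of_metric
    (c := fun z : frontier T.region => Metric.ball (z : ℂ) (r z)) T.isCompact_frontier
    (fun _ => Metric.isOpen_ball)
    (fun z hz => mem_iUnion.2 ⟨⟨z, hz⟩, Metric.mem_ball_self (hr z hz)⟩)
  refine ⟨δ, hδ, fun y hy => ?_⟩
  obtain ⟨z, hz⟩ := h y hy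
  exact (hs z z.2).mono hz

open Classical in
/-- The number of pairs of consecutive edges at reflex vertices which the needle meets. -/
def reflexCount (r : ℝ) (u x : ℂ) : ℝ :=
  ∑ i, if T.IsReflex i then
    (sweep r u (T.edge i) ∩ sweep r u (T.edge (T.next i))).indicator 1 x else 0

/-- The number of edges which the needle meets. -/
def edgeCount (r : ℝ) (u x : ℂ) : ℝ := ∑ i, (sweep r u (T.edge i)).indicator 1 x

/-- The needle from `x` is in general position: it contains no vertex, and its ends are not on the
frontier. -/
structure IsGeneric (r : ℝ) (u x : ℂ) : Prop where
  vertex : ∀ k, x ∉ sweep r u {T.outline k}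
  start : x ∉ frontier T.region
  finish : x + r * u ∉ frontier T.region

variable {T}

lemma counts_of_flatOn {r : ℝ} {u x z d : ℂ} {U : Set ℂ} (hr : 0 < r) (hx : T.IsGeneric r u x)
    (hU : ∀ t ∈ Icc 0 r, x + (t : ℝ) * u ∈ U) (hF : T.FlatOn z d U) (hd : cross d u ≠ 0)
    {t₀ : ℝ} (ht₀ : t₀ ∈ Icc 0 r) (hy : x + t₀ * u ∈ frontier T.region) :
    (2 : ℝ) = T.region.indicator 1 x + T.region.indicator 1 (x + r * u) + T.edgeCount r u x
      - 2 * T.reflexCount r u x := by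
  have hx0 : x ∈ U := by simpa using hU 0 (left_mem_Icc.2 hr.le)
  have hx1 := hU r (right_mem_Icc.2 hr.le)
  have hlin : ∀ t : ℝ, cross d (x + t * u - z) = cross d (x - z) + t * cross d u := fun t => by
    rw [← cross_ofReal_mul_right, ← cross_add_right]; congr 1; ring
  have e0 := (hF _ (hU t₀ ht₀)).2.1 hy
  rw [hlin] at e0
  have n0 : cross d (x - z) ≠ 0 := fun h => hx.start ((hF x hx0).2.2 h)
  have n1 : cross d (x - z) + r * cross d u ≠ 0 := fun h =>
    hx.finish ((hF _ hx1).2.2 (by rw [hlin]; exact h))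
  -- exactly one end of the needle is in the target
  have hends : T.region.indicator (1 : ℂ → ℝ) x + T.region.indicator 1 (x + r * u) = 1 := by
    have i0 := (hF x hx0).1
    have i1 := (hF _ hx1).1
    rw [hlin] at i1
    have hcase : (x ∈ T.region ∧ x + r * u ∉ T.region) ∨ (x ∉ T.region ∧ x + r * u ∈ T.region) := by
      rw [i0, i1]
      rcases lt_or_gt_of_ne n0 with h | h
      · have : 0 < cross d u := by
          by_contra! hc
          nlinarith [ht₀.1]
        exact Or.inr ⟨h.not_ge, by nlinarith [ht₀.2]⟩
      · have : cross d u < 0 := by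
          by_contra! hc
          nlinarith [ht₀.1]
        exact Or.inl ⟨h.le, fun hc => n1 (le_antisymm (by nlinarith [ht₀.2]) hc)⟩
    rcases hcase with ⟨h1, h2⟩ | ⟨h1, h2⟩ <;> simp [h1, h2]
  obtain ⟨j, hj⟩ := T.mem_frontier_iff.1 hy
  have huniq : ∀ i, x ∈ sweep r u (T.edge i) ↔ i = j := by
    intro i
    constructor
    · rintro ⟨t, ht, hti⟩
      have e1 := (hF _ (hU t ht)).2.1 (T.mem_frontier_iff.2 ⟨i, hti⟩)
      rw [hlin] at e1
      have : t = t₀ := mul_right_cancel₀ hd (by linarith)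
      rw [this] at hti
      exact T.edge_unique (fun k hk => hx.vertex k ⟨t₀, ht₀, hk⟩) hti hj
    · rintro rfl
      exact ⟨t₀, ht₀, hj⟩
  have hE : T.edgeCount r u x = 1 := by
    rw [edgeCount, Finset.sum_eq_single j]
    · rw [indicator_of_mem ((huniq j).2 rfl), Pi.one_apply]
    · intro i _ hi
      exact indicator_of_notMem (mt (huniq i).1 hi) _
    · simp
  have hR : T.reflexCount r u x = 0 := by
    refine Finset.sum_eq_zero fun i _ => ?_
    split_ifs
    · refine indicator_of_notMem (fun h => ?_) _
      exact T.next_ne_self i (((huniq _).1 h.2).trans ((huniq _).1 h.1).symm)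
    · rfl
  rw [hends, hE, hR]; norm_num

open Classical in
lemma counts_of_cornerOn {r : ℝ} {u x : ℂ} {i : Fin T.n} {U : Set ℂ} (hr : 0 < r)
    (hx : T.IsGeneric r u x) (hU : ∀ t ∈ Icc 0 r, x + (t : ℝ) * u ∈ U) (hF : T.CornerOn i U)
    (hD : cross (T.backVec i) (T.foreVec i) ≠ 0) (hP : cross (T.backVec i) u ≠ 0)
    (hQ : cross (T.foreVec i) u ≠ 0)
    {t₀ : ℝ} (ht₀ : t₀ ∈ Icc 0 r) (hy : x + t₀ * u ∈ frontier T.region) :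
    (2 : ℝ) = T.region.indicator 1 x + T.region.indicator 1 (x + r * u) + T.edgeCount r u x
      - 2 * T.reflexCount r u x := by
  set P := T.backVec i
  set Q := T.foreVec i
  set v := T.outline (T.next i)
  have hx0 : x ∈ U := by simpa using hU 0 (left_mem_Icc.2 hr.le)
  have hx1 := hU r (right_mem_Icc.2 hr.le)
  set a := coord P Q (x - v) with ha
  set b := coord Q P (x - v) with hb
  set p := coord P Q u with hp
  set q := coord Q P u with hq
  have hp0 : p ≠ 0 := by
    rw [hp, coord_apply]
    exact div_ne_zero (by rw [cross_swap]; exact neg_ne_zero.2 hQ) hD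
  have hq0 : q ≠ 0 := by
    rw [hq, coord_swap_apply]; exact div_ne_zero hP hD
  have hla : ∀ t : ℝ, coord P Q (x + t * u - v) = a + t * p := fun t => by
    rw [ha, hp, ← coord_ofReal_mul, ← map_add]; congr 1; ring
  have hlb : ∀ t : ℝ, coord Q P (x + t * u - v) = b + t * q := fun t => by
    rw [hb, hq, ← coord_ofReal_mul, ← map_add]; congr 1; ring
  have hi : x ∈ sweep r u (T.edge i) ↔ ∃ t ∈ Icc 0 r, b + t * q = 0 ∧ 0 ≤ a + t * p := by
    refine exists_congr fun t => and_congr_right fun ht => ?_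
    rw [(hF _ (hU t ht)).1.1, hla, hlb, and_comm]
  have hi' : x ∈ sweep r u (T.edge (T.next i)) ↔
      ∃ t ∈ Icc 0 r, a + t * p = 0 ∧ 0 ≤ b + t * q := by
    refine exists_congr fun t => and_congr_right fun ht => ?_
    rw [(hF _ (hU t ht)).1.2.1, hla, hlb]
  have hj : ∀ j, x ∈ sweep r u (T.edge j) → j = i ∨ j = T.next i := by
    rintro j ⟨t, ht, h⟩
    exact (hF _ (hU t ht)).1.2.2 j h
  have hapex : ∀ t ∈ Icc 0 r, a + t * p = 0 → b + t * q = 0 → False := by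
    intro t ht h1 h2
    refine hx.vertex (T.next i) ⟨t, ht, ?_⟩
    have := eq_coord_add hD (x + t * u - v)
    rw [hla, hlb, h1, h2, Complex.ofReal_zero, zero_mul, zero_mul, add_zero] at this
    exact sub_eq_zero.1 this
  have s1 : ¬ (0 ≤ a ∧ b = 0) := fun h =>
    hx.start (T.mem_frontier_iff.2 ⟨i, ((hF x hx0).1.1).2 h⟩)
  have s2 : ¬ (a = 0 ∧ 0 ≤ b) := fun h =>
    hx.start (T.mem_frontier_iff.2 ⟨_, ((hF x hx0).1.2.1).2 h⟩)
  have f1 : ¬ (0 ≤ a + r * p ∧ b + r * q = 0) := fun h =>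
    hx.finish (T.mem_frontier_iff.2 ⟨i, ((hF _ hx1).1.1).2 (by rw [hla, hlb]; exact h)⟩)
  have f2 : ¬ (a + r * p = 0 ∧ 0 ≤ b + r * q) := fun h =>
    hx.finish (T.mem_frontier_iff.2 ⟨_, ((hF _ hx1).1.2.1).2 (by rw [hla, hlb]; exact h)⟩)
  -- the ends of the needle are not on the sides of the sector
  have c0 : (0 ≤ a ∧ 0 ≤ b) ↔ (0 < a ∧ 0 < b) := by
    refine ⟨fun h => ⟨lt_of_le_of_ne h.1 fun e => s2 ⟨e.symm, h.2⟩,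
      lt_of_le_of_ne h.2 fun e => s1 ⟨h.1, e.symm⟩⟩, fun h => ⟨h.1.le, h.2.le⟩⟩
  have c1 : (0 ≤ a + r * p ∧ 0 ≤ b + r * q) ↔ (0 < a + r * p ∧ 0 < b + r * q) := by
    refine ⟨fun h => ⟨lt_of_le_of_ne h.1 fun e => f2 ⟨e.symm, h.2⟩,
      lt_of_le_of_ne h.2 fun e => f1 ⟨h.1, e.symm⟩⟩, fun h => ⟨h.1.le, h.2.le⟩⟩
  have hE : T.edgeCount r u x = (sweep r u (T.edge i)).indicator 1 x
      + (sweep r u (T.edge (T.next i))).indicator 1 x := by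
    refine Finset.sum_eq_add i (T.next i) (T.next_ne_self i).symm ?_ (by simp) (by simp)
    intro j _ hne
    exact indicator_of_notMem (fun h => (hj j h).elim hne.1 hne.2) _
  have hR : T.reflexCount r u x = if T.IsReflex i then
      (sweep r u (T.edge i) ∩ sweep r u (T.edge (T.next i))).indicator 1 x else 0 := by
    rw [reflexCount]
    refine Finset.sum_eq_single i ?_ (by simp)
    intro j _ hne
    split_ifs
    · refine indicator_of_notMem (fun h => ?_) _
      rcases hj j h.1 with h1 | h1
      · exact hne h1
      · rw [h1] at h
        rcases hj _ h.2 with h2 | h2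
        · exact T.next_next_ne_self i h2
        · exact T.next_ne_self _ h2
    · rfl
  -- the possible ways of meeting the two edges
  have hways : (x ∈ sweep r u (T.edge i) ∧ x ∈ sweep r u (T.edge (T.next i)) ∧
      ¬ (0 < a ∧ 0 < b) ∧ ¬ (0 < a + r * p ∧ 0 < b + r * q)) ∨
      (((x ∈ sweep r u (T.edge i) ∧ x ∉ sweep r u (T.edge (T.next i))) ∨
        (x ∉ sweep r u (T.edge i) ∧ x ∈ sweep r u (T.edge (T.next i)))) ∧
        (((0 < a ∧ 0 < b) ∧ ¬ (0 < a + r * p ∧ 0 < b + r * q)) ∨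
          (¬ (0 < a ∧ 0 < b) ∧ (0 < a + r * p ∧ 0 < b + r * q)))) := by
    obtain ⟨j, hyj⟩ := T.mem_frontier_iff.1 hy
    rcases hj j ⟨t₀, ht₀, hyj⟩ with h | h
    · have hm : x ∈ sweep r u (T.edge i) := ⟨t₀, ht₀, by rw [← h]; exact hyj⟩
      obtain ⟨t, ht, e1, e2⟩ := hi.1 hm
      have := quadrant_crossing hq0 ht e1 e2 hapex (fun h h' => s1 ⟨h', h⟩) (fun h h' => f1 ⟨h', h⟩)
      rw [← hi'] at this
      rcases this with ⟨k, k1, k2⟩ | ⟨k, ⟨k1, k2, k3⟩ | ⟨k1, k2, k3⟩⟩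
      · exact Or.inl ⟨hm, k, k1, k2⟩
      · exact Or.inr ⟨Or.inl ⟨hm, k⟩, Or.inl ⟨⟨k1, k2⟩, k3⟩⟩
      · exact Or.inr ⟨Or.inl ⟨hm, k⟩, Or.inr ⟨k1, k2, k3⟩⟩
    · have hm : x ∈ sweep r u (T.edge (T.next i)) := ⟨t₀, ht₀, by rw [← h]; exact hyj⟩
      obtain ⟨t, ht, e1, e2⟩ := hi'.1 hm
      have := quadrant_crossing hp0 ht e1 e2 (fun t ht h h' => hapex t ht h' h)
        (fun h h' => s2 ⟨h, h'⟩) (fun h h' => f2 ⟨h, h'⟩)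
      rw [← hi, and_comm (a := 0 < b + r * q), and_comm (a := 0 < b)] at this
      rcases this with ⟨k, k1, k2⟩ | ⟨k, ⟨k1, k2, k3⟩ | ⟨k1, k2, k3⟩⟩
      · exact Or.inl ⟨k, hm, k1, k2⟩
      · exact Or.inr ⟨Or.inr ⟨k, hm⟩, Or.inl ⟨⟨k2, k1⟩, k3⟩⟩
      · exact Or.inr ⟨Or.inr ⟨k, hm⟩, Or.inr ⟨k1, k2, k3⟩⟩
  rw [hE, hR]
  by_cases href : T.IsReflex i
  · have m0 := (hF x hx0).2.1 href
    have m1 := (hF _ hx1).2.1 href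
    rw [hla, hlb] at m1
    rw [if_pos href]
    rcases hways with ⟨h1, h2, h3, h4⟩ | ⟨⟨h1, h2⟩ | ⟨h1, h2⟩, ⟨h3, h4⟩ | ⟨h3, h4⟩⟩
    · rw [indicator_of_mem (m0.2 h3), indicator_of_mem (m1.2 h4), indicator_of_mem h1,
        indicator_of_mem h2, indicator_of_mem (mem_inter h1 h2)]
      norm_num
    · rw [indicator_of_notMem (fun h => m0.1 h h3), indicator_of_mem (m1.2 h4), indicator_of_mem h1,
        indicator_of_notMem h2, indicator_of_notMem (fun h => h2 h.2)]
      norm_num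
    · rw [indicator_of_mem (m0.2 h3), indicator_of_notMem (fun h => m1.1 h h4), indicator_of_mem h1,
        indicator_of_notMem h2, indicator_of_notMem (fun h => h2 h.2)]
      norm_num
    · rw [indicator_of_notMem (fun h => m0.1 h h3), indicator_of_mem (m1.2 h4),
        indicator_of_notMem h1, indicator_of_mem h2, indicator_of_notMem (fun h => h1 h.1)]
      norm_num
    · rw [indicator_of_mem (m0.2 h3), indicator_of_notMem (fun h => m1.1 h h4),
        indicator_of_notMem h1, indicator_of_mem h2, indicator_of_notMem (fun h => h1 h.1)]
      norm_num
  · have m0 := ((hF x hx0).2.2 href).trans c0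
    have m1 := (hF _ hx1).2.2 href
    rw [hla, hlb, c1] at m1
    rw [if_neg href]
    rcases hways with ⟨h1, h2, h3, h4⟩ | ⟨⟨h1, h2⟩ | ⟨h1, h2⟩, ⟨h3, h4⟩ | ⟨h3, h4⟩⟩
    · rw [indicator_of_notMem (mt m0.1 h3), indicator_of_notMem (mt m1.1 h4), indicator_of_mem h1,
        indicator_of_mem h2]
      norm_num
    · rw [indicator_of_mem (m0.2 h3), indicator_of_notMem (mt m1.1 h4), indicator_of_mem h1,
        indicator_of_notMem h2]
      norm_num
    · rw [indicator_of_notMem (mt m0.1 h3), indicator_of_mem (m1.2 h4), indicator_of_mem h1,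
        indicator_of_notMem h2]
      norm_num
    · rw [indicator_of_mem (m0.2 h3), indicator_of_notMem (mt m1.1 h4), indicator_of_notMem h1,
        indicator_of_mem h2]
      norm_num
    · rw [indicator_of_notMem (mt m0.1 h3), indicator_of_mem (m1.2 h4), indicator_of_notMem h1,
        indicator_of_mem h2]
      norm_num

/-- **Counting for a short needle in general position**: the number of components of its
intersection with the target is half the number of its ends in the target plus half the number of
edges it meets; it is at most one, unless the needle bridges a reflex corner. -/
lemma two_mul_indicator_sweep {r δ : ℝ} {u x : ℂ} (hr : 0 < r) (hrδ : r < δ) (hu : ‖u‖ = 1)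
    (hδ : ∀ y ∈ frontier T.region, T.SimpleOn (Metric.ball y δ))
    (hpar : ∀ i, cross (T.edgeVec i) u ≠ 0) (hx : T.IsGeneric r u x) :
    2 * (sweep r u T.region).indicator (1 : ℂ → ℝ) x
      = T.region.indicator 1 x + T.region.indicator 1 (x + r * u) + T.edgeCount r u x
        - 2 * T.reflexCount r u x := by
  by_cases hy : ∃ t₀ ∈ Icc 0 r, x + (t₀ : ℝ) * u ∈ frontier T.region
  · obtain ⟨t₀, ht₀, hy⟩ := hy
    rw [indicator_of_mem (show x ∈ sweep r u T.region from
      ⟨t₀, ht₀, T.isClosed_region.frontier_subset hy⟩), Pi.one_apply, mul_one]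
    have hU : ∀ t ∈ Icc 0 r, x + (t : ℝ) * u ∈ Metric.ball (x + t₀ * u) δ := by
      intro t ht
      rw [Metric.mem_ball, dist_eq_norm, show x + t * u - (x + t₀ * u) = (t - t₀ : ℝ) * u by
        push_cast; ring, norm_mul, hu, mul_one, Complex.norm_real, Real.norm_eq_abs]
      exact (abs_le.2 ⟨by linarith [ht.1, ht₀.2], by linarith [ht.2, ht₀.1]⟩).trans_lt hrδ
    rcases hδ _ hy with ⟨z, i, h | h⟩ | ⟨i, hD, h⟩
    · exact counts_of_flatOn hr hx hU h (hpar i) ht₀ hy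
    · exact counts_of_flatOn hr hx hU h (by rw [cross_neg_left]; exact neg_ne_zero.2 (hpar i))
        ht₀ hy
    · exact counts_of_cornerOn hr hx hU h hD
        (by rw [backVec, cross_neg_left]; exact neg_ne_zero.2 (hpar i)) (hpar _) ht₀ hy
  · push Not at hy
    have hno : ∀ i, x ∉ sweep r u (T.edge i) := by
      rintro i ⟨t, ht, h⟩
      exact hy t ht (T.mem_frontier_iff.2 ⟨i, h⟩)
    have hE : T.edgeCount r u x = 0 :=
      Finset.sum_eq_zero fun i _ => indicator_of_notMem (hno i) _
    have hR : T.reflexCount r u x = 0 := by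
      refine Finset.sum_eq_zero fun i _ => ?_
      split_ifs
      · exact indicator_of_notMem (fun h => hno i h.1) _
      · rfl
    rw [hE, hR]
    have hpre : IsPreconnected ((fun t : ℝ => x + t * u) '' Icc 0 r) :=
      isPreconnected_Icc.image _ (by fun_prop)
    have hm0 : x ∈ (fun t : ℝ => x + t * u) '' Icc 0 r := ⟨0, left_mem_Icc.2 hr.le, by simp⟩
    have hm1 : x + r * u ∈ (fun t : ℝ => x + t * u) '' Icc 0 r := ⟨r, right_mem_Icc.2 hr.le, rfl⟩
    rcases subset_or_disjoint_of_frontier (S := T.region) hpre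
      (by rintro _ ⟨t, ht, rfl⟩; exact hy t ht) with h | h
    · rw [indicator_of_mem (h hm0), indicator_of_mem (h hm1),
        indicator_of_mem (show x ∈ sweep r u T.region from
          ⟨0, left_mem_Icc.2 hr.le, by simpa using h hm0⟩)]
      norm_num
    · rw [indicator_of_notMem (h _ hm0), indicator_of_notMem (h _ hm1), indicator_of_notMem]
      · norm_num
      · rintro ⟨t, ht, h'⟩
        exact h _ ⟨t, ht, rfl⟩ h'

end Target

/-! ### Integration over all positions and directions -/

lemma volume_segment (a b : ℂ) : volume (segment ℝ a b) = 0 := by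
  have : segment ℝ a b ⊆ (fun p : ℝ × ℝ => a + (p.1 * (b - a) + p.2 * (0 : ℂ))) '' univ := by
    rw [segment_eq_image']
    rintro _ ⟨s, _, rfl⟩
    exact ⟨(s, 0), mem_univ _, by simp⟩
  refine measure_mono_null this ?_
  rw [volume_image_frame]; simp

lemma integrable_indicator_one {A : Set ℂ} (hA : IsCompact A) :
    Integrable (A.indicator (1 : ℂ → ℝ)) :=
  (integrable_indicator_iff hA.measurableSet).2
    ((integrableOn_const (C := (1 : ℝ)) hA.measure_lt_top.ne))

lemma ae_cross_dir_ne_zero {P : ℂ} (hP : P ≠ 0) : ∀ᵐ θ : ℝ, cross P (dir θ) ≠ 0 := by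
  obtain ⟨α, hα⟩ := exists_eq_norm_mul_dir P
  have hn : ‖P‖ ≠ 0 := norm_ne_zero_iff.2 hP
  have hc : (range fun n : ℤ => n * Real.pi + α).Countable := countable_range _
  filter_upwards [hc.ae_notMem volume] with θ hθ h
  rw [cross_dir_eq hα, mul_eq_zero, or_iff_right hn, Real.sin_eq_zero_iff] at h
  obtain ⟨n, hn⟩ := h
  exact hθ ⟨n, by simp only; linarith⟩

lemma abs_cross_le (P u : ℂ) : |cross P u| ≤ ‖P‖ * ‖u‖ := by
  have : cross P u = ((starRingEnd ℂ) P * u).im := by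
    simp only [cross, Complex.mul_im, Complex.conj_re, Complex.conj_im]; ring
  rw [this]
  calc _ ≤ ‖(starRingEnd ℂ) P * u‖ := Complex.abs_im_le_norm _
    _ = _ := by rw [norm_mul, RCLike.norm_conj]

namespace Target

variable (T : Target)

lemma isCompact_edge (i : Fin T.n) : IsCompact (T.edge i) := isCompact_segment _ _

lemma volume_frontier : volume (frontier T.region) = 0 := by
  have : frontier T.region = ⋃ i, T.edge i := by
    ext w; rw [mem_frontier_iff, mem_iUnion]
  rw [this]
  exact measure_iUnion_null fun i => volume_segment _ _

lemma ae_isGeneric {r : ℝ} (hr : 0 < r) (u : ℂ) : ∀ᵐ x : ℂ, T.IsGeneric r u x := by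
  have h1 : ∀ᵐ x : ℂ, ∀ k, x ∉ sweep r u {T.outline k} :=
    ae_all_iff.2 fun k => measure_eq_zero_iff_ae_notMem.1 (volume_sweep_singleton hr u _)
  have h2 : ∀ᵐ x : ℂ, x ∉ frontier T.region := measure_eq_zero_iff_ae_notMem.1 T.volume_frontier
  have h3 : ∀ᵐ x : ℂ, x ∉ (fun x => x + r * u) ⁻¹' frontier T.region :=
    measure_eq_zero_iff_ae_notMem.1 (by rw [measure_preimage_add_right]; exact T.volume_frontier)
  filter_upwards [h1, h2, h3] with x a b c using ⟨a, b, c⟩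

open Classical in
/-- The area of the set of starting points of the needles of a given direction that meet
the target. -/
lemma two_mul_volume_sweep {r δ : ℝ} {u : ℂ} (hr : 0 < r) (hrδ : r < δ) (hu : ‖u‖ = 1)
    (hδ : ∀ y ∈ frontier T.region, T.SimpleOn (Metric.ball y δ))
    (hpar : ∀ i, cross (T.edgeVec i) u ≠ 0) :
    2 * volume.real (sweep r u T.region) = 2 * T.area + (∑ i, r * |cross (T.edgeVec i) u|)
      - 2 * ∑ i, if T.IsReflex i then
        volume.real (sweep r u (T.edge i) ∩ sweep r u (T.edge (T.next i))) else 0 := by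
  have hsw : ∀ i, IsCompact (sweep r u (T.edge i)) := fun i => isCompact_sweep (T.isCompact_edge i) r u
  have hin : ∀ i, IsCompact (sweep r u (T.edge i) ∩ sweep r u (T.edge (T.next i))) := fun i =>
    (hsw i).inter (hsw _)
  have iT := integrable_indicator_one T.isCompact
  have iT' : Integrable fun x => T.region.indicator (1 : ℂ → ℝ) (x + r * u) := iT.comp_add_right _
  have iE : Integrable (T.edgeCount r u) :=
    integrable_finsetSum _ fun i _ => integrable_indicator_one (hsw i)
  have iRi : ∀ i, Integrable fun x => if T.IsReflex i then
      (sweep r u (T.edge i) ∩ sweep r u (T.edge (T.next i))).indicator (1 : ℂ → ℝ) x else 0 := by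
    intro i
    split_ifs
    · exact integrable_indicator_one (hin i)
    · exact integrable_zero _ _ _
  have iR : Integrable (T.reflexCount r u) := integrable_finsetSum _ fun i _ => iRi i
  have iTT : Integrable fun x =>
      T.region.indicator (1 : ℂ → ℝ) x + T.region.indicator 1 (x + r * u) := iT.add iT'
  have iS : Integrable fun x => T.region.indicator (1 : ℂ → ℝ) x
      + T.region.indicator 1 (x + r * u) + T.edgeCount r u x := iTT.add iE
  have hint := integral_congr_ae (μ := volume) ((T.ae_isGeneric hr u).mono fun x hx =>
    two_mul_indicator_sweep hr hrδ hu hδ hpar hx)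
  have eE : ∫ x, T.edgeCount r u x = ∑ i, r * |cross (T.edgeVec i) u| := by
    unfold edgeCount
    rw [integral_finsetSum _ fun i _ => integrable_indicator_one (hsw i)]
    refine Finset.sum_congr rfl fun i _ => ?_
    rw [integral_indicator_one (hsw i).measurableSet, measureReal_def, edge,
      volume_sweep_segment hr, ENNReal.toReal_ofReal (by positivity)]
    rfl
  have eR : ∫ x, T.reflexCount r u x = ∑ i, if T.IsReflex i then
      volume.real (sweep r u (T.edge i) ∩ sweep r u (T.edge (T.next i))) else 0 := by
    unfold reflexCount
    rw [integral_finsetSum _ fun i _ => iRi i]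
    refine Finset.sum_congr rfl fun i _ => ?_
    split_ifs
    · rw [integral_indicator_one (hin i).measurableSet]
    · simp
  rw [integral_const_mul, integral_indicator_one (isCompact_sweep T.isCompact r u).measurableSet,
    integral_sub iS (iR.const_mul 2), integral_add iTT iE,
    integral_add iT iT',
    integral_add_right_eq_self (fun x => T.region.indicator (1 : ℂ → ℝ) x),
    integral_indicator_one T.isCompact.measurableSet, integral_const_mul, eE, eR] at hint
  rw [hint, area]
  ring

/-- The integral over all directions of the area of the set of starting points of the needles of
length `r` that meet the target is a quadratic polynomial in `r`, as long as `r` is small. -/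
lemma exists_integral_volume_sweep : ∃ ε > 0, ∀ r : ℝ, 0 < r → r < ε →
    ∫ θ in (0 : ℝ)..(2 * Real.pi), volume.real (sweep r (dir θ) T.region)
      = 2 * Real.pi * T.area + 2 * r * T.perimeter + r ^ 2 / 4 * T.concavity := by
  classical
  obtain ⟨δ, hδ, hS⟩ := T.exists_scale
  -- at every corner, short needles meeting both sides do not reach the far ends of the edges
  have hsmall : ∀ᶠ r : ℝ in 𝓝[>] 0, ∀ i, cross (T.backVec i) (T.foreVec i) ≠ 0 →
      r * ‖T.backVec i‖ ≤ |cross (T.backVec i) (T.foreVec i)| ∧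
      r * ‖T.foreVec i‖ ≤ |cross (T.backVec i) (T.foreVec i)| := by
    rw [eventually_all]
    intro i
    by_cases h : cross (T.backVec i) (T.foreVec i) = 0
    · exact Eventually.of_forall fun _ h' => absurd h h'
    have hpos : 0 < |cross (T.backVec i) (T.foreVec i)| := abs_pos.2 h
    have aux : ∀ c : ℝ, ∀ᶠ r : ℝ in 𝓝[>] 0, r * c ≤ |cross (T.backVec i) (T.foreVec i)| := by
      intro c
      have hc : Continuous fun r : ℝ => r * c := by fun_prop
      exact (((hc.tendsto 0).mono_left nhdsWithin_le_nhds).eventually_lt_const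
        (by simpa using hpos)).mono fun _ h => h.le
    filter_upwards [aux ‖T.backVec i‖, aux ‖T.foreVec i‖] with r h1 h2 _ using ⟨h1, h2⟩
  obtain ⟨η, hη, hsub⟩ := mem_nhdsGT_iff_exists_Ioo_subset.1 hsmall
  refine ⟨min δ η, lt_min hδ hη, fun r hr hrε => ?_⟩
  have hcorner := hsub ⟨hr, hrε.trans_le (min_le_right _ _)⟩
  have hrδ := hrε.trans_le (min_le_left _ _)
  set W : Fin T.n → ℝ → ℝ := fun i θ =>
    max 0 (cross (T.backVec i) (dir θ) * cross (T.foreVec i) (dir θ)) /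
      |cross (T.backVec i) (T.foreVec i)| with hW
  have hWc : ∀ i, Continuous (W i) := fun i =>
    (continuous_const.max (((continuous_cross_right _).comp continuous_dir).mul
      ((continuous_cross_right _).comp continuous_dir))).div_const _
  have hEc : ∀ i, Continuous fun θ => |cross (T.edgeVec i) (dir θ)| := fun i =>
    ((continuous_cross_right _).comp continuous_dir).abs
  have hae : ∀ᵐ θ : ℝ, volume.real (sweep r (dir θ) T.region)
      = (T.area + ∑ i, r / 2 * |cross (T.edgeVec i) (dir θ)|)
        - ∑ i, if T.IsReflex i then r ^ 2 / 2 * W i θ else 0 := by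
    have hpar : ∀ᵐ θ : ℝ, ∀ i, cross (T.edgeVec i) (dir θ) ≠ 0 :=
      ae_all_iff.2 fun i => ae_cross_dir_ne_zero (T.edgeVec_ne_zero i)
    filter_upwards [hpar] with θ hθ
    have h := T.two_mul_volume_sweep hr hrδ (norm_dir θ) hS hθ
    have e1 : ∑ i, r / 2 * |cross (T.edgeVec i) (dir θ)|
        = (∑ i, r * |cross (T.edgeVec i) (dir θ)|) / 2 := by
      rw [Finset.sum_div]
      exact Finset.sum_congr rfl fun i _ => by ring
    have e2 : (∑ i, if T.IsReflex i then
        volume.real (sweep r (dir θ) (T.edge i) ∩ sweep r (dir θ) (T.edge (T.next i))) else 0)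
        = ∑ i, if T.IsReflex i then r ^ 2 / 2 * W i θ else 0 := by
      refine Finset.sum_congr rfl fun i _ => ?_
      split_ifs with hi
      · obtain ⟨c1, c2⟩ := hcorner i hi.1
        have aux : ∀ Z : ℂ, r * ‖Z‖ ≤ |cross (T.backVec i) (T.foreVec i)| →
            r * |cross Z (dir θ)| ≤ |cross (T.backVec i) (T.foreVec i)| := by
          intro Z hZ
          refine le_trans ?_ hZ
          have := abs_cross_le Z (dir θ)
          rw [norm_dir, mul_one] at this
          exact mul_le_mul_of_nonneg_left this hr.le
        rw [measureReal_def, edge_eq_back, edge_next_eq_fore, volume_sweep_inter hr hi.1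
          (by rw [backVec, cross_neg_left]; exact neg_ne_zero.2 (hθ i)) (hθ _) (aux _ c1) (aux _ c2),
          ENNReal.toReal_ofReal (mul_nonneg (by positivity)
            (div_nonneg (le_max_left _ _) (abs_nonneg _)))]
      · rfl
    rw [e2] at h
    rw [e1]
    linarith
  have hRi : ∀ i, Continuous fun θ => if T.IsReflex i then r ^ 2 / 2 * W i θ else 0 := by
    intro i
    split_ifs
    · exact (hWc i).const_mul _
    · exact continuous_const
  have hEi : ∀ i, Continuous fun θ => r / 2 * |cross (T.edgeVec i) (dir θ)| := fun i =>
    (hEc i).const_mul _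
  have hcE : Continuous fun θ => ∑ i, r / 2 * |cross (T.edgeVec i) (dir θ)| :=
    continuous_finsetSum _ fun i _ => hEi i
  have hcA : Continuous fun θ => T.area + ∑ i, r / 2 * |cross (T.edgeVec i) (dir θ)| :=
    continuous_const.add hcE
  have hcR : Continuous fun θ => ∑ i, if T.IsReflex i then r ^ 2 / 2 * W i θ else 0 :=
    continuous_finsetSum _ fun i _ => hRi i
  rw [intervalIntegral.integral_congr_ae (hae.mono fun θ h _ => h), intervalIntegral.integral_sub
    (hcA.intervalIntegrable _ _) (hcR.intervalIntegrable _ _),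
    intervalIntegral.integral_add (continuous_const.intervalIntegrable _ _)
      (hcE.intervalIntegrable _ _),
    intervalIntegral.integral_const,
    intervalIntegral.integral_finsetSum fun i _ => (hEi i).intervalIntegrable _ _,
    intervalIntegral.integral_finsetSum fun i _ => (hRi i).intervalIntegrable _ _]
  have e1 : ∑ i, ∫ θ in (0 : ℝ)..(2 * Real.pi), r / 2 * |cross (T.edgeVec i) (dir θ)|
      = 2 * r * T.perimeter := by
    rw [perimeter, Finset.mul_sum]
    refine Finset.sum_congr rfl fun i _ => ?_
    rw [intervalIntegral.integral_const_mul, integral_abs_cross_dir, edgeLength, dist_comm,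
      dist_eq_norm, edgeVec]
    ring
  have e2 : ∑ i, ∫ θ in (0 : ℝ)..(2 * Real.pi), (if T.IsReflex i then r ^ 2 / 2 * W i θ else 0)
      = -(r ^ 2 / 4 * T.concavity) := by
    rw [concavity_eq, Finset.mul_sum, ← Finset.sum_neg_distrib]
    refine Finset.sum_congr rfl fun i _ => ?_
    split_ifs
    · rw [intervalIntegral.integral_const_mul, cornerIntegral]
      ring
    · simp
  rw [e1, e2, smul_eq_mul]
  ring

end Target

/-! ### The probabilities -/

lemma measuredDistance_le_iff {S : Set ℂ} (hS : IsClosed S) {rmax r : ℝ} (hr : r ≤ rmax) (x : ℂ)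
    (θ : ℝ) : measuredDistance S rmax x θ ≤ (r : EReal) ↔ x ∈ sweep r (dir θ) S := by
  set A : Set ℝ := {s : ℝ | 0 ≤ s ∧ s ≤ rmax ∧ x + s * Complex.exp (θ * Complex.I) ∈ S} with hA
  have hmem : ∀ s, s ∈ A ↔ s ∈ Icc 0 rmax ∧ x + s * dir θ ∈ S := fun s => by
    rw [hA, mem_ofPred_eq, mem_Icc, and_assoc]; rfl
  change sInf ((fun s : ℝ => (s : EReal)) '' A) ≤ r ↔ _
  constructor
  · intro h
    have hne : A.Nonempty := by
      by_contra hc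
      rw [not_nonempty_iff_eq_empty.1 hc, image_empty, sInf_empty] at h
      exact absurd h (not_le.2 (EReal.coe_lt_top r))
    have hcl : IsClosed A := by
      have : A = Icc 0 rmax ∩ (fun s : ℝ => x + s * dir θ) ⁻¹' S := by
        ext s; exact hmem s
      rw [this]
      exact isClosed_Icc.inter (hS.preimage (by fun_prop))
    have hcpt : IsCompact A := isCompact_Icc.of_isClosed_subset hcl fun s hs => ((hmem s).1 hs).1
    obtain ⟨s, hs, hmin⟩ := hcpt.exists_isLeast hne
    have hs' : sInf ((fun s : ℝ => (s : EReal)) '' A) = s := by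
      refine le_antisymm (sInf_le ⟨s, hs, rfl⟩) (le_sInf ?_)
      rintro _ ⟨t, ht, rfl⟩
      exact EReal.coe_le_coe_iff.2 (hmin ht)
    rw [hs', EReal.coe_le_coe_iff] at h
    exact ⟨s, ⟨((hmem s).1 hs).1.1, h⟩, ((hmem s).1 hs).2⟩
  · rintro ⟨s, hs, h⟩
    have hsA : s ∈ A := (hmem s).2 ⟨⟨hs.1, hs.2.trans hr⟩, h⟩
    exact (sInf_le (mem_image_of_mem _ hsA)).trans (EReal.coe_le_coe_iff.2 hs.2)

lemma measuredDistance_nonneg (S : Set ℂ) (rmax : ℝ) (x : ℂ) (θ : ℝ) :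
    0 ≤ measuredDistance S rmax x θ := by
  refine le_sInf ?_
  rintro _ ⟨s, hs, rfl⟩
  exact EReal.coe_nonneg.2 hs.1

lemma isClosed_setOf_mem_sweep {S : Set ℂ} (hS : IsClosed S) (r : ℝ) :
    IsClosed {q : ℂ × ℝ | q.1 ∈ sweep r (dir q.2) S} := by
  have hcl : IsClosed {p : (ℂ × ℝ) × Icc (0 : ℝ) r | p.1.1 + (p.2 : ℝ) * dir p.1.2 ∈ S} :=
    hS.preimage (by fun_prop)
  have := isClosedMap_fst_of_compactSpace _ hcl
  convert this using 1
  ext q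
  constructor
  · rintro ⟨t, ht, h⟩
    exact ⟨(q, ⟨t, ht⟩), h, rfl⟩
  · rintro ⟨⟨_, t⟩, h, rfl⟩
    exact ⟨t, t.2, h⟩

/-- The volume of the set of pairs of a position and a direction for which the needle of length `r`
meets a compact set. -/
lemma volume_real_setOf_mem_sweep {S : Set ℂ} (hS : IsCompact S) (r : ℝ) :
    volume.real {q : ℂ × ℝ | q.2 ∈ Ico 0 (2 * Real.pi) ∧ q.1 ∈ sweep r (dir q.2) S}
      = ∫ θ in (0 : ℝ)..(2 * Real.pi), volume.real (sweep r (dir θ) S) := by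
  have hK := (isClosed_setOf_mem_sweep hS.isClosed r).measurableSet
  have hset : MeasurableSet {q : ℂ × ℝ | q.2 ∈ Ico 0 (2 * Real.pi) ∧ q.1 ∈ sweep r (dir q.2) S} :=
    (measurableSet_Ico.preimage measurable_snd).inter hK
  have hmeas : Measurable fun θ : ℝ => volume (sweep r (dir θ) S) :=
    measurable_measure_prodMk_right hK
  have hslice : ∀ θ : ℝ, volume ((fun x : ℂ => (x, θ)) ⁻¹'
      {q : ℂ × ℝ | q.2 ∈ Ico 0 (2 * Real.pi) ∧ q.1 ∈ sweep r (dir q.2) S})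
      = (Ico 0 (2 * Real.pi)).indicator (fun θ => volume (sweep r (dir θ) S)) θ := by
    intro θ
    by_cases hθ : θ ∈ Ico 0 (2 * Real.pi)
    · rw [indicator_of_mem hθ]
      congr 1
      ext x
      exact and_iff_right hθ
    · rw [indicator_of_notMem hθ, ← measure_empty (μ := (volume : Measure ℂ))]
      congr 1
      ext x
      exact ⟨fun h => hθ h.1, fun h => h.elim⟩
  rw [measureReal_def, Measure.volume_eq_prod, Measure.prod_apply_symm hset]
  simp_rw [hslice]
  rw [lintegral_indicator measurableSet_Ico, ← integral_toReal hmeas.aemeasurable.restrict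
    (Eventually.of_forall fun θ => (isCompact_sweep hS r (dir θ)).measure_lt_top),
    intervalIntegral.integral_of_le (by positivity), integral_Ico_eq_integral_Ioc]
  rfl

namespace Setting

variable (M : Setting)

lemma volume_real_pos : 0 < volume.real M.Ω := by
  have h0 : 0 < M.T.n := lt_of_lt_of_le (by norm_num) M.T.three_le
  have hmem : M.T.outline ⟨0, h0⟩ ∈ M.T.region := M.T.isClosed_region.frontier_subset
    (M.T.mem_frontier_iff.2 ⟨_, M.T.left_mem_edge _⟩)
  rw [measureReal_def, ENNReal.toReal_pos_iff]
  refine ⟨?_, M.volume_ne_top.lt_top⟩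
  exact (Metric.measure_closedBall_pos volume _ M.rmax_pos).trans_le
    (measure_mono (M.closedBall_subset _ hmem))

lemma probLE_eq {r : ℝ} (hr : r ≤ M.rmax) :
    M.probLE r = (∫ θ in (0 : ℝ)..(2 * Real.pi), volume.real (sweep r (dir θ) M.T.region))
      / (2 * Real.pi * volume.real M.Ω) := by
  have hbox : MeasurableSet (M.Ω ×ˢ Ico 0 (2 * Real.pi)) := M.measurableSet.prod measurableSet_Ico
  have hset : (M.Ω ×ˢ Ico 0 (2 * Real.pi)) ∩
      {q : ℂ × ℝ | measuredDistance M.T.region M.rmax q.1 q.2 ≤ (r : EReal)}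
      = {q : ℂ × ℝ | q.2 ∈ Ico 0 (2 * Real.pi) ∧ q.1 ∈ sweep r (dir q.2) M.T.region} := by
    ext q
    rw [mem_inter_iff, mem_prod, mem_ofPred_eq, measuredDistance_le_iff M.T.isClosed_region hr,
      mem_ofPred_eq]
    refine ⟨fun h => ⟨h.1.2, h.2⟩, fun h => ⟨⟨?_, h.1⟩, h.2⟩⟩
    obtain ⟨t, ht, hx⟩ := h.2
    refine M.closedBall_subset _ hx ?_
    rw [Metric.mem_closedBall, dist_eq_norm, sub_add_cancel_left, norm_neg, norm_mul, norm_dir,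
      mul_one, Complex.norm_real, Real.norm_eq_abs, abs_of_nonneg ht.1]
    exact ht.2.trans hr
  rw [probLE, sensorLaw, measureReal_def, ProbabilityTheory.cond_apply hbox, hset,
    ENNReal.toReal_mul, ← measureReal_def, volume_real_setOf_mem_sweep M.T.isCompact,
    Measure.volume_eq_prod, Measure.prod_prod, Real.volume_Ico, sub_zero, ENNReal.toReal_inv,
    ENNReal.toReal_mul, ENNReal.toReal_ofReal (by positivity), ← measureReal_def, div_eq_inv_mul,
    mul_comm (volume.real M.Ω)]

lemma probZero_eq : M.probZero = M.T.area / volume.real M.Ω := by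
  have h : M.probZero = M.probLE 0 := by
    rw [probZero, probLE]
    congr 1
    ext q
    exact ⟨fun h => le_of_eq h, fun h => le_antisymm h (measuredDistance_nonneg _ _ _ _)⟩
  have hs : ∀ u, sweep 0 u M.T.region = M.T.region := by
    intro u
    ext x
    simp [sweep]
  have := M.volume_real_pos
  rw [h, M.probLE_eq M.rmax_pos.le]
  simp_rw [hs]
  rw [intervalIntegral.integral_const, sub_zero, smul_eq_mul, Target.area]
  field_simp

lemma exists_probLE_eq : ∃ ε > 0, ∀ r : ℝ, 0 < r → r < ε →
    M.probLE r = (2 * Real.pi * M.T.area + 2 * r * M.T.perimeter + r ^ 2 / 4 * M.T.concavity)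
      / (2 * Real.pi * volume.real M.Ω) := by
  obtain ⟨ε, hε, h⟩ := M.T.exists_integral_volume_sweep
  refine ⟨min ε M.rmax, lt_min hε M.rmax_pos, fun r hr hrε => ?_⟩
  rw [M.probLE_eq (hrε.le.trans (min_le_right _ _)), h r hr (hrε.trans_le (min_le_left _ _))]

end Setting

/-! ### Decoding -/

/-- The increment `P(s ≤ r) - P(s = 0)` as a measure (of total mass `2π |Ω|`), divided by `r`. For
small ranges this is `2 L + r G / 4`. -/
def rangeSlope (W s p₀ p : ℝ) : ℝ := 2 * Real.pi * W * (p - p₀) / s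

/-- The value of `G(T)` decoded from the data, as a divided difference. -/
def decodeConcavity (W s₁ s₂ p₀ p₁ p₂ : ℝ) : ℝ :=
  4 * (rangeSlope W s₁ p₀ p₁ - rangeSlope W s₂ p₀ p₂) / (s₁ - s₂)

/-- The value of `L(T)` decoded from the data. -/
def decodePerimeter (W s₁ s₂ p₀ p₁ p₂ : ℝ) : ℝ :=
  (rangeSlope W s₁ p₀ p₁ - s₁ / 4 * decodeConcavity W s₁ s₂ p₀ p₁ p₂) / 2

namespace Setting

variable (M : Setting)

/-- For small ranges the decoding is correct. -/
lemma exists_decode : ∃ ε > 0, ∀ s₁ s₂ : ℝ, 0 < s₁ → s₁ < ε → 0 < s₂ → s₂ < ε → s₁ ≠ s₂ →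
    decodeConcavity (volume.real M.Ω) s₁ s₂ M.probZero (M.probLE s₁) (M.probLE s₂)
      = M.T.concavity ∧
    decodePerimeter (volume.real M.Ω) s₁ s₂ M.probZero (M.probLE s₁) (M.probLE s₂)
      = M.T.perimeter := by
  obtain ⟨ε, hε, h⟩ := M.exists_probLE_eq
  have hW := M.volume_real_pos
  have hslope : ∀ s, 0 < s → s < ε → rangeSlope (volume.real M.Ω) s M.probZero (M.probLE s)
      = 2 * M.T.perimeter + s / 4 * M.T.concavity := by
    intro s h0 hs
    rw [rangeSlope, h s h0 hs, M.probZero_eq]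
    field_simp
    ring
  refine ⟨ε, hε, fun s₁ s₂ h1 h1' h2 h2' hne => ?_⟩
  have hc : decodeConcavity (volume.real M.Ω) s₁ s₂ M.probZero (M.probLE s₁) (M.probLE s₂)
      = M.T.concavity := by
    rw [decodeConcavity, hslope _ h1 h1', hslope _ h2 h2', div_eq_iff (sub_ne_zero.2 hne)]
    ring
  refine ⟨hc, ?_⟩
  rw [decodePerimeter, hc, hslope _ h1 h1']
  ring

end Setting

end DistanceSensing

end

theorem theorem4 :
    DistanceSensing.ObservableFromSmallRanges (fun M => M.T.perimeter) ∧
    DistanceSensing.ObservableFromSmallRanges (fun M => M.T.area) ∧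
    DistanceSensing.ObservableFromSmallRanges (fun M => M.T.concavity) ∧
    (∀ φ : ℝ, Real.pi < φ → φ < 2 * Real.pi → DistanceSensing.g₁ φ < 0) ∧
    (∀ T : DistanceSensing.Target,
      (Convex ℝ T.region → T.concavity = 0) ∧ (¬ Convex ℝ T.region → T.concavity < 0)) ∧
    DistanceSensing.ObservableFromSmallRanges (fun M => Convex ℝ M.T.region) := by
  have hconv : ∀ T : DistanceSensing.Target,
      (Convex ℝ T.region → T.concavity = 0) ∧ (¬ Convex ℝ T.region → T.concavity < 0) := by
    refine fun T => ⟨fun h => T.concavity_eq_zero (T.not_isReflex_of_convex h), fun h => ?_⟩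
    have hex : ∃ i, T.IsReflex i := by
      by_contra! hc
      exact h (T.convex_of_forall_not_isReflex hc)
    obtain ⟨i, hi⟩ := hex
    exact T.concavity_neg hi
  refine ⟨⟨DistanceSensing.decodePerimeter, fun M => ?_⟩,
    ⟨fun W _ _ p₀ _ _ => p₀ * W, fun M => ⟨1, one_pos, fun s₁ s₂ _ _ _ _ _ => ?_⟩⟩,
    ⟨DistanceSensing.decodeConcavity, fun M => ?_⟩,
    fun φ => DistanceSensing.g₁_neg, hconv,
    ⟨fun W s₁ s₂ p₀ p₁ p₂ => DistanceSensing.decodeConcavity W s₁ s₂ p₀ p₁ p₂ = 0, fun M => ?_⟩⟩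
  · obtain ⟨ε, hε, h⟩ := M.exists_decode
    exact ⟨ε, hε, fun s₁ s₂ h1 h1' h2 h2' hne => (h s₁ s₂ h1 h1' h2 h2' hne).2⟩
  · simp only
    rw [M.probZero_eq, div_mul_cancel₀ _ M.volume_real_pos.ne']
  · obtain ⟨ε, hε, h⟩ := M.exists_decode
    exact ⟨ε, hε, fun s₁ s₂ h1 h1' h2 h2' hne => (h s₁ s₂ h1 h1' h2 h2' hne).1⟩
  · obtain ⟨ε, hε, h⟩ := M.exists_decode
    refine ⟨ε, hε, fun s₁ s₂ h1 h1' h2 h2' hne => ?_⟩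
    simp only
    rw [(h s₁ s₂ h1 h1' h2 h2' hne).1, eq_iff_iff]
    refine ⟨fun h0 => ?_, (hconv M.T).1⟩
    by_contra hc
    exact ((hconv M.T).2 hc).ne h0
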